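/- **Theorem B.2.** There are universal constants $C>0$, $k\in\mathbb N$ and, for every $d\ge 1$ and $\varepsilon>0$, an adaptive algorithm (which may use classical randomness) with black-box access to an unknown unitary $Z\in \mathrm U(d)$, such that the following holds. * *Space.* The quantum memory of the algorithm consists of two qudits of dimension $d$ and one qubit. The algorithm may apply $Z$ to the first qudit, apply unitary operations given by ancilla-free circuits, prepare a register in a computational basis state (discarding its content), and measure a register in the computational basis; it does not use the inverse of $Z$ or controlled applications of $Z$. * *Queries.* It applies $Z$ at most $C\,\frac d\varepsilon\,\log^2 d$ times. * *Gates.* Let each qudit be embedded in $\lceil \log_2 d\rceil$ qubits, and call elementary operations the one- and two-qubit gates and the preparations and measurements of single qubits. Call a *run* any part of the execution that lasts until the second qudit is replaced by a freshly prepared one, or until the output. Beyond the applications of $Z$, the algorithm uses in each run at most $C\log^k(2+d/\varepsilon)$ elementary operations, and in total at most $C\,d\,\log^k(2+d/\varepsilon)$. * *Output.* It outputs a finite set $\widehat\Theta\subset[0,2\pi)$ and, for every $Z\in\mathrm U(d)$, except with probability at most $d^{-100}$, $$\min_{\tau\in[0,2\pi)} d_{\mathrm H}(\Theta+\tau,\widehat\Theta)\le\varepsilon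 ,$$ where $\Theta=\{\theta\in[0,2\pi): e^{i\theta}\text{ is an eigenvalue of }Z\}$ and $d_{\mathrm H}$ is the Hausdorff distance in $\mathbb R/2\pi\mathbb Z$ (infinite between a nonempty set and the empty set). The bounds on queries, elementary operations per run, and elementary operations in total hold in the worst case over measurement outcomes and random choices. -/

import Mathlib

open scoped Kronecker

noncomputable section

namespace EigenphaseEstimation

/-! ### Eigenphases and Hausdorff distance up to a global shift -/

/-- The set of eigenphases of `Z`, as a subset of `[0, 2π)`. -/
def eigenphases {d : ℕ} (Z : Matrix (Fin d) (Fin d) ℂ) : Set ℝ :=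
  {θ | θ ∈ Set.Ico 0 (2 * Real.pi) ∧
    Module.End.HasEigenvalue (Matrix.toLin' Z) (Complex.exp (θ * Complex.I))}

/-- The image of a set of reals in the circle `ℝ / 2πℤ` (with its quotient metric),
after translation by `τ`. -/
def onCircle (τ : ℝ) (A : Set ℝ) : Set (AddCircle (2 * Real.pi)) :=
  (fun θ : ℝ => ((θ + τ : ℝ) : AddCircle (2 * Real.pi))) '' A

/-- Hausdorff distance in `ℝ / 2πℤ` up to a global shift. It is extended-valued, so that the
distance from a nonempty set to the empty set is `∞`. -/
def shiftHausdorff (A B : Set ℝ) : ENNReal :=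
  ⨅ τ ∈ Set.Ico 0 (2 * Real.pi), Metric.hausdorffEDist (onCircle τ A) (onCircle 0 B)

/-! ### Two qudits and one qubit -/

/-- Labels of the computational basis of `ℂ^d ⊗ ℂ^d ⊗ ℂ^2`. -/
abbrev Basis (d : ℕ) : Type := Fin d × Fin d × Bool

/-- The three registers: two qudits of dimension `d` and a qubit. -/
inductive Register : Type
  | first
  | second
  | qubit

/-- Labels of the computational basis of one register. -/
abbrev Level (d : ℕ) : Register → Type
  | .first => Fin d
  | .second => Fin d
  | .qubit => Bool

instance (d : ℕ) : (r : Register) → Fintype (Level d r)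
  | .first => inferInstanceAs (Fintype (Fin d))
  | .second => inferInstanceAs (Fintype (Fin d))
  | .qubit => inferInstanceAs (Fintype Bool)

instance (d : ℕ) : (r : Register) → DecidableEq (Level d r)
  | .first => inferInstanceAs (DecidableEq (Fin d))
  | .second => inferInstanceAs (DecidableEq (Fin d))
  | .qubit => inferInstanceAs (DecidableEq Bool)

/-- The content of register `r` in a computational basis state. -/
def get {d : ℕ} (r : Register) (x : Basis d) : Level d r :=
  match r with
  | .first => x.1
  | .second => x.2.1
  | .qubit => x.2.2

/-- Replace the content of register `r` in a computational basis state. -/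
def put {d : ℕ} (r : Register) (l : Level d r) (x : Basis d) : Basis d :=
  match r, l with
  | .first, l => (l, x.2.1, x.2.2)
  | .second, l => (x.1, l, x.2.2)
  | .qubit, l => (x.1, x.2.1, l)

/-- The number of qubits in which a qudit of dimension `d` is embedded: `⌈log₂ d⌉`. -/
def quditBits (d : ℕ) : ℕ := Nat.clog 2 d

/-- The number of qubits that a register occupies. -/
def registerBits (d : ℕ) : Register → ℕ
  | .first => quditBits d
  | .second => quditBits d
  | .qubit => 1

/-! ### Circuits of one- and two-qubit gates on `2 ⌈log₂ d⌉ + 1` qubits -/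

/-- The qubits carrying the first qudit, the second qudit, and the extra qubit. -/
abbrev Wire (n : ℕ) : Type := Fin n ⊕ Fin n ⊕ Unit

/-- The embedding of basis labels into bit strings, through binary expansion. -/
def encode {d : ℕ} (x : Basis d) : Wire (quditBits d) → Bool
  | .inl i => Nat.testBit x.1 i
  | .inr (.inl i) => Nat.testBit x.2.1 i
  | .inr (.inr _) => x.2.2

/-- An arbitrary unitary gate on one or on two distinct qubits. -/
inductive Gate (n : ℕ) : Type
  | one (a : Wire n) (U : Matrix.unitaryGroup Bool ℂ)
  | two (a b : Wire n) (hab : a ≠ b) (U : Matrix.unitaryGroup (Bool × Bool) ℂ)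

/-- The action of a gate on all the qubits. -/
def Gate.matrix {n : ℕ} : Gate n → Matrix (Wire n → Bool) (Wire n → Bool) ℂ
  | .one a U => Matrix.of fun x y =>
      if ∀ w, w ≠ a → x w = y w then (U : Matrix Bool Bool ℂ) (x a) (y a) else 0
  | .two a b _ U => Matrix.of fun x y =>
      if ∀ w, w ≠ a → w ≠ b → x w = y w then
        (U : Matrix (Bool × Bool) (Bool × Bool) ℂ) (x a, x b) (y a, y b) else 0

/-- The action of a circuit, whose gates are listed in order of execution. -/
def circuitMatrix {n : ℕ} : List (Gate n) → Matrix (Wire n → Bool) (Wire n → Bool) ℂ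
  | [] => 1
  | g :: c => circuitMatrix c * g.matrix

/-- A unitary operation on two qudits and a qubit, with an ancilla-free circuit which realizes it
on the embedded space. (As `op` is unitary, `spec` says that the circuit maps the embedded space
to itself, and acts there as `op`.) -/
structure GateOp (d : ℕ) : Type where
  op : Matrix.unitaryGroup (Basis d) ℂ
  circuit : List (Gate (quditBits d))
  spec : ∀ x y : Basis d,
    circuitMatrix circuit (encode x) (encode y) = (op : Matrix (Basis d) (Basis d) ℂ) x y

/-! ### Algorithms -/

/-- Adaptive algorithms with oracle access to an unknown unitary channel of dimension `d`, whose
quantum memory consists of two qudits and one qubit. The steps are: output a finite set of phases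
in `[0, 2π)`; apply the unknown unitary to the first qudit; apply a unitary operation that is given
by a circuit; discard the content of a register and prepare it in a computational basis
state; measure a register in the computational basis, and continue depending on the outcome;
draw a uniformly random element of a finite set, and continue depending on it. -/
inductive Algorithm (d : ℕ) : Type
  | output (S : Finset ℝ) (hS : (S : Set ℝ) ⊆ Set.Ico 0 (2 * Real.pi))
  | query (next : Algorithm d)
  | apply (V : GateOp d) (next : Algorithm d)
  | prepare (r : Register) (l : Level d r) (next : Algorithm d)
  | measure (r : Register) (next : Level d r → Algorithm d)
  | random (m : ℕ) (next : Fin (m + 1) → Algorithm d)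

/-- Density operators on two qudits and one qubit (unnormalized: the trace is the probability of
having reached the present point of the computation). -/
abbrev State (d : ℕ) : Type := Matrix (Basis d) (Basis d) ℂ

/-- The initial state: all the registers hold `|0⟩`. -/
def initialState (d : ℕ) : State d := Matrix.of fun x y =>
  if (x.1.val = 0 ∧ x.2.1.val = 0 ∧ x.2.2 = false) ∧
    (y.1.val = 0 ∧ y.2.1.val = 0 ∧ y.2.2 = false) then 1 else 0

/-- The unknown unitary, applied to the first qudit. -/
def onFirst {d : ℕ} (Z : Matrix (Fin d) (Fin d) ℂ) : Matrix (Basis d) (Basis d) ℂ :=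
  Z ⊗ₖ (1 : Matrix (Fin d × Bool) (Fin d × Bool) ℂ)

/-- Trace out register `r`, and prepare it in the basis state `l`. -/
def prepared {d : ℕ} (r : Register) (l : Level d r) (ρ : State d) : State d :=
  Matrix.of fun x y =>
    if get r x = l ∧ get r y = l then ∑ k : Level d r, ρ (put r k x) (put r k y) else 0

/-- The unnormalized state after a measurement of register `r` with outcome `l`. -/
def measured {d : ℕ} (r : Register) (l : Level d r) (ρ : State d) : State d :=
  Matrix.of fun x y => if get r x = l ∧ get r y = l then ρ x y else 0

open Classical in
/-- The probability that the algorithm, started in the state `ρ` with oracle `Z`, outputs a set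
with property `E`. -/
def Algorithm.probFrom {d : ℕ} (Z : Matrix (Fin d) (Fin d) ℂ) (E : Finset ℝ → Prop) :
    Algorithm d → State d → ℝ
  | .output S _, ρ => if E S then ρ.trace.re else 0
  | .query p, ρ => p.probFrom Z E (onFirst Z * ρ * (onFirst Z).conjTranspose)
  | .apply V p, ρ => p.probFrom Z E
      ((V.op : Matrix (Basis d) (Basis d) ℂ) * ρ *
        (V.op : Matrix (Basis d) (Basis d) ℂ).conjTranspose)
  | .prepare r l p, ρ => p.probFrom Z E (prepared r l ρ)
  | .measure r p, ρ => ∑ l : Level d r, (p l).probFrom Z E (measured r l ρ)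
  | .random m p, ρ => (∑ i : Fin (m + 1), (p i).probFrom Z E ρ) / (m + 1 : ℝ)

/-- The probability that the algorithm with oracle `Z` outputs a set with property `E`. -/
def Algorithm.prob {d : ℕ} (p : Algorithm d) (Z : Matrix (Fin d) (Fin d) ℂ)
    (E : Finset ℝ → Prop) : ℝ :=
  p.probFrom Z E (initialState d)

/-! ### Costs, in the worst case over outcomes and random choices -/

/-- The number of applications of the unknown unitary. -/
def Algorithm.queries {d : ℕ} : Algorithm d → ℕ
  | .output _ _ => 0
  | .query p => p.queries + 1
  | .apply _ p => p.queries
  | .prepare _ _ p => p.queries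
  | .measure r p => Finset.univ.sup fun l : Level d r => (p l).queries
  | .random _ p => Finset.univ.sup fun i => (p i).queries

/-- The total number of elementary operations beyond the applications of the unknown unitary:
one- and two-qubit gates, and preparations and measurements of single qubits. -/
def Algorithm.gates {d : ℕ} : Algorithm d → ℕ
  | .output _ _ => 0
  | .query p => p.gates
  | .apply V p => p.gates + V.circuit.length
  | .prepare r _ p => p.gates + registerBits d r
  | .measure r p => (Finset.univ.sup fun l : Level d r => (p l).gates) + registerBits d r
  | .random _ p => Finset.univ.sup fun i => (p i).gates

/-- The number of elementary operations, beyond the applications of the unknown unitary, until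
the second qudit is replaced by a fresh one (or until the output, if this does not occur). -/
def Algorithm.currentRun {d : ℕ} : Algorithm d → ℕ
  | .output _ _ => 0
  | .query p => p.currentRun
  | .apply V p => p.currentRun + V.circuit.length
  | .prepare .second _ _ => registerBits d .second
  | .prepare .first _ p => p.currentRun + registerBits d .first
  | .prepare .qubit _ p => p.currentRun + registerBits d .qubit
  | .measure r p => (Finset.univ.sup fun l : Level d r => (p l).currentRun) + registerBits d r
  | .random _ p => Finset.univ.sup fun i => (p i).currentRun

/-- The greatest number of elementary operations, beyond the applications of the unknown unitary,
in any one run; a run lasts until the second qudit is replaced by a fresh one. -/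
def Algorithm.gatesPerRun {d : ℕ} : Algorithm d → ℕ
  | .output _ _ => 0
  | .query p => p.gatesPerRun
  | .apply V p => max (Algorithm.apply V p).currentRun p.gatesPerRun
  | .prepare r l p => max (Algorithm.prepare r l p).currentRun p.gatesPerRun
  | .measure r p => max (Algorithm.measure r p).currentRun
      (Finset.univ.sup fun l : Level d r => (p l).gatesPerRun)
  | .random _ p => Finset.univ.sup fun i => (p i).gatesPerRun

end EigenphaseEstimation

end

/-! Let the qudits hold eigenvectors `u`, `v` with eigenvalues `μ`, `ν`. A swap controlled by a
qubit in superposition, then `Z ^ t` on the first qudit, then the same swap, restores `u ⊗ v` and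
leaves the relative phase `(ν / μ) ^ t` on the qubit. So a Hadamard test reads phase differences
without controlled `Z`, and it leaves both eigenvectors intact for further tests
(`probLE_hadamardTest`).

A uniformly random basis state is a maximally mixed state, which is also the uniform mixture of any
eigenbasis of `Z`; preparing one amounts to drawing an unknown eigenvector (`sum_prepared_second`).
The first qudit is drawn once and kept as a common reference, so that all estimates are relative to
one phase `θ a`; this is the global shift. The second is drawn of order `d log d` times, which by
the coupon collector argument meets every eigenvector with high probability (`probLE_runs`).

In each run the cosine and sine of `2 ^ j` times the phase difference are estimated to constant
accuracy for `j ≤ J`, with `2 ^ J` of order `1 / ε`; this determines the phase to precision `2 ^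
(-J)` (`norm_coe_le_of_cos`). The power `2 ^ j` is tested `36 (K + J - j)` times for each of the
two. As the costly powers are repeated least, the queries sum to order `2 ^ J K`, without a factor
`log (1 / ε)`, while the failure probabilities still sum to order `2 ^ (-K)`. With `K` of order `log
d`, the runs use of order `(d / ε) log² d` queries.

All probabilities are bounded by induction backwards through the program: `ProbLE` carries a
potential that bounds the chance of a bad output from the present point on, and every instruction
keeps it under control. -/

open scoped Kronecker

noncomputable section

namespace EigenphaseEstimation

/-! ### Diagonalization of unitary matrices -/

section Isometry

variable {E : Type*} [NormedAddCommGroup E] [InnerProductSpace ℂ E]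
  {T : Module.End ℂ E}

/-- An isometry is injective, so in finite dimension it maps an invariant subspace onto itself;
hence it maps the orthogonal complement into itself, and this is an invariant complement. -/
theorem isSemisimple_of_inner_map [FiniteDimensional ℂ E]
    (hT : ∀ x y, inner ℂ (T x) (T y) = inner ℂ x y) : T.IsSemisimple := by
  rw [Module.End.isSemisimple_iff]
  intro p hp
  refine ⟨pᗮ, ?_, Submodule.isCompl_orthogonal p⟩
  have hinj : Function.Injective T := by
    rw [← LinearMap.ker_eq_bot, LinearMap.ker_eq_bot']
    intro x hx
    have := hT x x
    rw [hx, inner_zero_left] at this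
    exact inner_self_eq_zero.mp this.symm
  have hmap : p.map T = p := by
    apply Submodule.eq_of_le_of_finrank_eq
    · exact Submodule.map_le_iff_le_comap.mpr hp
    · exact (Submodule.equivMapOfInjective T hinj p).finrank_eq.symm
  intro x hx y hy
  rw [← hmap] at hy
  obtain ⟨z, hz, rfl⟩ := hy
  rw [hT]
  exact hx z hz

/-- If `⟨x, y⟩ ≠ 0`, invariance of `⟨x, x⟩` and `⟨x, y⟩` gives `conj μ * μ = 1 = conj μ * ν`, so the
eigenvalues agree. -/
theorem orthogonalFamily_eigenspaces_of_inner_map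
    (hT : ∀ x y, inner ℂ (T x) (T y) = inner ℂ x y) :
    OrthogonalFamily ℂ (fun μ : Module.End.Eigenvalues T => Module.End.eigenspace T (μ : ℂ))
      fun μ => (Module.End.eigenspace T (μ : ℂ)).subtypeₗᵢ := by
  rintro ⟨μ, hμ⟩ ⟨ν, hν⟩ hne ⟨x, hx⟩ ⟨y, hy⟩
  have hx' : T x = μ • x := Module.End.mem_eigenspace_iff.mp hx
  have hy' : T y = ν • y := Module.End.mem_eigenspace_iff.mp hy
  change inner ℂ x y = 0
  have h1 := hT x x
  have h2 := hT x y
  rw [hx', inner_smul_left, inner_smul_right] at h1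
  rw [hx', hy', inner_smul_left, inner_smul_right] at h2
  by_contra hxy
  have hx0 : inner ℂ x x ≠ 0 := by
    intro h
    exact hxy (by rw [inner_self_eq_zero.mp h, inner_zero_left])
  have e1 : (starRingEnd ℂ) μ * μ = 1 := by
    apply mul_right_cancel₀ hx0
    linear_combination h1
  have e2 : (starRingEnd ℂ) μ * ν = 1 := by
    apply mul_right_cancel₀ hxy
    linear_combination h2
  have hμ0 : (starRingEnd ℂ) μ ≠ 0 := left_ne_zero_of_mul_eq_one e1
  exact hne (Subtype.ext (mul_left_cancel₀ hμ0 (e1.trans e2.symm)))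

theorem exists_orthonormalBasis_of_inner_map [FiniteDimensional ℂ E] {n : ℕ}
    (hn : Module.finrank ℂ E = n) (hT : ∀ x y, inner ℂ (T x) (T y) = inner ℂ x y) :
    ∃ (b : OrthonormalBasis (Fin n) ℂ E) (μ : Fin n → ℂ), ∀ i, T (b i) = μ i • b i := by
  have hV := orthogonalFamily_eigenspaces_of_inner_map hT
  have hint : DirectSum.IsInternal
      fun μ : Module.End.Eigenvalues T => Module.End.eigenspace T (μ : ℂ) := by
    rw [hV.isInternal_iff, Submodule.orthogonal_eq_bot_iff,
      ← (isSemisimple_of_inner_map hT).iSup_eigenspace_eq_top]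
    apply le_antisymm
    · exact iSup_le fun μ => le_iSup (fun ν : ℂ => Module.End.eigenspace T ν) μ
    · refine iSup_le fun μ => ?_
      by_cases hμ : T.HasEigenvalue μ
      · exact le_iSup (fun ν : Module.End.Eigenvalues T => Module.End.eigenspace T (ν : ℂ)) ⟨μ, hμ⟩
      · rw [Module.End.hasEigenvalue_iff, not_not] at hμ
        rw [hμ]
        exact bot_le
  refine ⟨hint.subordinateOrthonormalBasis hn hV,
    fun i => ((hint.subordinateOrthonormalBasisIndex hn i hV : Module.End.Eigenvalues T) : ℂ),
    fun i => ?_⟩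
  exact Module.End.mem_eigenspace_iff.mp (hint.subordinateOrthonormalBasis_subordinate hn i hV)

end Isometry

/-- An orthonormal eigenbasis `v` of `Z`, with eigenvalues `exp (i θ)`. -/
structure IsEigenbasis {d : ℕ} (Z : Matrix (Fin d) (Fin d) ℂ) (v : Fin d → Fin d → ℂ)
    (θ : Fin d → ℝ) : Prop where
  mem_Ico : ∀ a, θ a ∈ Set.Ico 0 (2 * Real.pi)
  mulVec : ∀ a, Z.mulVec (v a) = Complex.exp (θ a * Complex.I) • v a
  ortho : ∀ a b, ∑ i, star (v a i) * v b i = if a = b then 1 else 0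
  complete : ∀ i j, ∑ a, v a i * star (v a j) = if i = j then 1 else 0

theorem exists_isEigenbasis {d : ℕ} {Z : Matrix (Fin d) (Fin d) ℂ}
    (hZ : Z ∈ Matrix.unitaryGroup (Fin d) ℂ) : ∃ v θ, IsEigenbasis Z v θ := by
  set T : Module.End ℂ (EuclideanSpace ℂ (Fin d)) := Matrix.toEuclideanLin Z with hTdef
  have hT : ∀ x y, inner ℂ (T x) (T y) = inner ℂ x y := by
    intro x y
    simp only [hTdef, Matrix.toLpLin_apply, EuclideanSpace.inner_eq_star_dotProduct,
      Matrix.star_mulVec]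
    rw [dotProduct_comm, ← Matrix.dotProduct_mulVec, Matrix.mulVec_mulVec,
      ← Matrix.star_eq_conjTranspose, Matrix.mem_unitaryGroup_iff'.mp hZ, Matrix.one_mulVec,
      dotProduct_comm]
  obtain ⟨b, μ, hb⟩ := exists_orthonormalBasis_of_inner_map (finrank_euclideanSpace_fin (n := d)) hT
  have hnorm : ∀ a, ‖μ a‖ = 1 := by
    intro a
    have h := hT (b a) (b a)
    rw [hb, inner_smul_left, inner_smul_right] at h
    have hb1 : inner ℂ (b a) (b a) = 1 := by
      rw [inner_self_eq_norm_sq_to_K, b.norm_eq_one]; simp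
    rw [hb1, mul_one, Complex.conj_mul'] at h
    have : ‖μ a‖ ^ 2 = 1 := by exact_mod_cast h
    nlinarith [norm_nonneg (μ a)]
  have hortho : ∀ a c, ∑ i, star (b a i) * b c i = if a = c then 1 else 0 := by
    intro a c
    rw [← b.inner_eq_ite a c, EuclideanSpace.inner_eq_star_dotProduct, dotProduct]
    exact Finset.sum_congr rfl fun i _ => mul_comm _ _
  refine ⟨fun a => b a, fun a => toIcoMod Real.two_pi_pos 0 (Complex.arg (μ a)),
    fun a => ?_, fun a => ?_, hortho, ?_⟩
  · simpa using toIcoMod_mem_Ico Real.two_pi_pos 0 (Complex.arg (μ a))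
  · have h1 : Complex.exp ((toIcoMod Real.two_pi_pos 0 (Complex.arg (μ a)) : ℝ) * Complex.I)
        = μ a := by
      have h2 : ((toIcoMod Real.two_pi_pos 0 (Complex.arg (μ a)) : ℝ) : ℂ) * Complex.I =
          Complex.arg (μ a) * Complex.I -
            toIcoDiv Real.two_pi_pos 0 (Complex.arg (μ a)) * (2 * Real.pi * Complex.I) := by
        rw [toIcoMod]; push_cast; simp; ring
      rw [h2, Complex.exp_sub, Complex.exp_int_mul_two_pi_mul_I, div_one]
      have := Complex.norm_mul_exp_arg_mul_I (μ a)
      rwa [hnorm a, Complex.ofReal_one, one_mul] at this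
    rw [h1]
    have := congrArg WithLp.ofLp (hb a)
    simpa [hTdef, Matrix.toLpLin_apply] using this
  -- Orthonormality says `Vᴴ V = 1`; completeness is `V Vᴴ = 1`, which follows as `V` is square.
  · set V : Matrix (Fin d) (Fin d) ℂ := Matrix.of fun i a => b a i
    have h1 : V.conjTranspose * V = 1 := by
      ext a c
      simp only [Matrix.mul_apply, Matrix.conjTranspose_apply, V, Matrix.of_apply, hortho,
        Matrix.one_apply]
    have h2 := mul_eq_one_comm.mp h1
    intro i j
    have := congrFun (congrFun h2 i) j
    simpa only [Matrix.mul_apply, Matrix.conjTranspose_apply, V, Matrix.of_apply,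
      Matrix.one_apply] using this

theorem exp_mul_I_injOn {x y : ℝ} (hx : x ∈ Set.Ico 0 (2 * Real.pi))
    (hy : y ∈ Set.Ico 0 (2 * Real.pi))
    (h : Complex.exp (x * Complex.I) = Complex.exp (y * Complex.I)) : x = y := by
  obtain ⟨n, hn⟩ := Complex.exp_eq_exp_iff_exists_int.mp h
  have h1 : x = y + n * (2 * Real.pi) := by
    have := congrArg Complex.im hn
    simpa using this
  have h2 := Real.two_pi_pos
  have h3 : n = 0 := by
    have a1 : (n : ℝ) * (2 * Real.pi) < 1 * (2 * Real.pi) := by linarith [hx.2, hy.1]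
    have a2 : (-1 : ℝ) * (2 * Real.pi) < n * (2 * Real.pi) := by linarith [hx.1, hy.2]
    have b1 := lt_of_mul_lt_mul_right a1 h2.le
    have b2 := lt_of_mul_lt_mul_right a2 h2.le
    norm_cast at b1 b2
    omega
  simpa [h3] using h1

theorem IsEigenbasis.eigenphases_eq {d : ℕ} {Z : Matrix (Fin d) (Fin d) ℂ}
    {v : Fin d → Fin d → ℂ} {θ : Fin d → ℝ} (h : IsEigenbasis Z v θ) :
    eigenphases Z = Set.range θ := by
  ext φ
  constructor
  · rintro ⟨hφ, hev⟩
    obtain ⟨x, hx⟩ := hev.exists_hasEigenvector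
    have hx1 : Z.mulVec x = Complex.exp (φ * Complex.I) • x := by
      simpa using hx.apply_eq_smul
    have hx0 : x ≠ 0 := hx.2
    set c : Fin d → ℂ := fun a => ∑ i, star (v a i) * x i
    have hxc : x = ∑ a, c a • v a := by
      ext i
      simp only [c, Finset.sum_apply, Pi.smul_apply, smul_eq_mul, Finset.sum_mul]
      rw [Finset.sum_comm]
      have : ∀ j, ∑ a, star (v a j) * x j * v a i = (if i = j then 1 else 0) * x j := by
        intro j
        rw [← h.complete i j, Finset.sum_mul]
        exact Finset.sum_congr rfl fun a _ => by ring
      simp only [this, ite_mul, one_mul, zero_mul, Finset.sum_ite_eq, Finset.mem_univ, if_true]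
    have hcv : ∀ (f : Fin d → ℂ) a, ∑ i, star (v a i) * (∑ b, f b • v b) i = f a := by
      intro f a
      simp only [Finset.sum_apply, Pi.smul_apply, smul_eq_mul, Finset.mul_sum]
      rw [Finset.sum_comm]
      have : ∀ b, ∑ i, star (v a i) * (f b * v b i) = f b * (if a = b then 1 else 0) := by
        intro b
        rw [← h.ortho a b, Finset.mul_sum]
        exact Finset.sum_congr rfl fun a _ => by ring
      simp only [this, mul_ite, mul_one, mul_zero, Finset.sum_ite_eq, Finset.mem_univ, if_true]
    -- An eigenvector has a nonzero component along some `v a`; comparing that component of `Z x` in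
    -- two ways identifies the eigenvalue with that of `v a`.
    obtain ⟨a, ha⟩ : ∃ a, c a ≠ 0 := by
      by_contra! hc
      exact hx0 (by rw [hxc]; simp [hc])
    refine ⟨a, (exp_mul_I_injOn hφ (h.mem_Ico a) ?_).symm⟩
    have h1 : Z.mulVec x = ∑ b, (c b * Complex.exp (θ b * Complex.I)) • v b := by
      conv_lhs => rw [hxc]
      rw [Matrix.mulVec_sum]
      exact Finset.sum_congr rfl fun b _ => by rw [Matrix.mulVec_smul, h.mulVec, smul_smul]
    have h2 : Z.mulVec x = ∑ b, (Complex.exp (φ * Complex.I) * c b) • v b := by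
      rw [hx1]
      conv_lhs => rw [hxc]
      rw [Finset.smul_sum]
      exact Finset.sum_congr rfl fun b _ => by rw [smul_smul]
    have h3 : c a * Complex.exp (θ a * Complex.I) = Complex.exp (φ * Complex.I) * c a := by
      have e1 := hcv (fun b => c b * Complex.exp (θ b * Complex.I)) a
      have e2 := hcv (fun b => Complex.exp (φ * Complex.I) * c b) a
      rw [← h1] at e1
      rw [← h2] at e2
      exact e1.symm.trans e2
    apply mul_right_cancel₀ ha
    rw [← h3, mul_comm]
  · rintro ⟨a, rfl⟩
    refine ⟨h.mem_Ico a, Module.End.hasEigenvalue_of_hasEigenvector (x := v a) ⟨?_, ?_⟩⟩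
    · rw [Module.End.mem_eigenspace_iff, Matrix.toLin'_apply, h.mulVec]
    · intro h0
      have := h.ortho a a
      simp [h0] at this

/-! ### Circuits -/

theorem Gate.one_mulVec {n : ℕ} (a : Wire n) (U : Matrix.unitaryGroup Bool ℂ)
    (ψ : (Wire n → Bool) → ℂ) (x : Wire n → Bool) :
    (Gate.one a U).matrix.mulVec ψ x =
      ∑ p, (U : Matrix Bool Bool ℂ) (x a) p * ψ (Function.update x a p) := by
  symm
  apply Fintype.sum_of_injective (fun p => Function.update x a p)
    (Function.update_injective x a)
  · intro y hy
    simp only [Gate.matrix, Matrix.of_apply]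
    rw [if_neg, zero_mul]
    intro h
    refine hy ⟨y a, funext fun w => ?_⟩
    by_cases hw : w = a
    · subst hw; simp
    · simp [hw, h w hw]
  · intro p
    simp only [Gate.matrix, Matrix.of_apply, Function.update_self]
    rw [if_pos]
    intro w hw
    simp [hw]

theorem Gate.two_mulVec {n : ℕ} {a b : Wire n} (hab : a ≠ b)
    (U : Matrix.unitaryGroup (Bool × Bool) ℂ)
    (ψ : (Wire n → Bool) → ℂ) (x : Wire n → Bool) :
    (Gate.two a b hab U).matrix.mulVec ψ x =
      ∑ p : Bool × Bool, (U : Matrix (Bool × Bool) (Bool × Bool) ℂ) (x a, x b) p *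
        ψ (Function.update (Function.update x a p.1) b p.2) := by
  symm
  apply Fintype.sum_of_injective
    (fun p : Bool × Bool => Function.update (Function.update x a p.1) b p.2)
  · rintro ⟨p, q⟩ ⟨p', q'⟩ h
    have h1 := congrFun h a
    have h2 := congrFun h b
    simp only [Function.update_self, Function.update_of_ne hab] at h1 h2
    rw [h1, h2]
  · intro y hy
    simp only [Gate.matrix, Matrix.of_apply]
    rw [if_neg, zero_mul]
    intro h
    refine hy ⟨(y a, y b), funext fun w => ?_⟩
    by_cases hw : w = b
    · subst hw; simp
    · by_cases hw' : w = a
      · subst hw'; simp [hw]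
      · simp [hw, hw', h w hw' hw]
  · rintro ⟨p, q⟩
    simp only [Gate.matrix, Matrix.of_apply, Function.update_self, Function.update_of_ne hab]
    rw [if_pos]
    intro w hw hw'
    simp [hw, hw']

theorem circuitMatrix_cons_mulVec {n : ℕ} (g : Gate n) (c : List (Gate n))
    (ψ : (Wire n → Bool) → ℂ) :
    (circuitMatrix (g :: c)).mulVec ψ = (circuitMatrix c).mulVec (g.matrix.mulVec ψ) := by
  rw [Matrix.mulVec_mulVec]; rfl

theorem circuitMatrix_append {n : ℕ} (c e : List (Gate n)) :
    circuitMatrix (c ++ e) = circuitMatrix e * circuitMatrix c := by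
  induction c with
  | nil => simp [circuitMatrix]
  | cons g c ih => simp [circuitMatrix, ih, Matrix.mul_assoc]

/-- The controlled negation as a `4 × 4` matrix, with target the first qubit. -/
def cnotUnitary : Matrix.unitaryGroup (Bool × Bool) ℂ :=
  ⟨Matrix.of fun p q => if q = (xor p.1 p.2, p.2) then 1 else 0, by
    rw [Matrix.mem_unitaryGroup_iff]
    ext ⟨p, q⟩ ⟨p', q'⟩
    rw [Matrix.mul_apply, Fintype.sum_eq_single (xor p q, q)]
    · cases p <;> cases q <;> cases p' <;> cases q' <;> simp [Matrix.star_apply]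
    · intro r hr
      simp [hr]⟩

/-- Negate `a` if `b` holds. -/
def cnotGate {n : ℕ} {a b : Wire n} (hab : a ≠ b) : Gate n := .two a b hab cnotUnitary

theorem cnotGate_mulVec {n : ℕ} {a b : Wire n} (hab : a ≠ b) (ψ : (Wire n → Bool) → ℂ)
    (x : Wire n → Bool) :
    (cnotGate hab).matrix.mulVec ψ x = ψ (Function.update x a (xor (x a) (x b))) := by
  rw [cnotGate, Gate.two_mulVec, Fintype.sum_eq_single (xor (x a) (x b), x b)]
  · simp only [cnotUnitary, Matrix.of_apply, if_true, one_mul]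
    congr 1
    ext w
    by_cases hw : w = b
    · subst hw; simp [hab.symm]
    · simp [hw]
  · intro p hp
    simp [cnotUnitary, hp]

/-- The controlled phase as a `4 × 4` matrix. -/
def cphaseUnitary (s : unitary ℂ) : Matrix.unitaryGroup (Bool × Bool) ℂ :=
  ⟨Matrix.diagonal fun p => if p.1 && p.2 then (s : ℂ) else 1, by
    rw [Matrix.mem_unitaryGroup_iff, Matrix.star_eq_conjTranspose, Matrix.diagonal_conjTranspose,
      Matrix.diagonal_mul_diagonal, ← Matrix.diagonal_one]
    congr 1
    ext ⟨p, q⟩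
    have : (s : ℂ) * (starRingEnd ℂ) s = 1 := Unitary.mul_star_self_of_mem s.2
    cases p <;> cases q <;> simp [this]⟩

/-- Multiply by the phase `s` if `a` and `b` hold. -/
def cphaseGate {n : ℕ} {a b : Wire n} (hab : a ≠ b) (s : unitary ℂ) : Gate n :=
  .two a b hab (cphaseUnitary s)

theorem cphaseGate_mulVec {n : ℕ} {a b : Wire n} (hab : a ≠ b) (s : unitary ℂ)
    (ψ : (Wire n → Bool) → ℂ) (x : Wire n → Bool) :
    (cphaseGate hab s).matrix.mulVec ψ x = (if x a && x b then (s : ℂ) else 1) * ψ x := by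
  rw [cphaseGate, Gate.two_mulVec, Fintype.sum_eq_single (x a, x b)]
  · simp [cphaseUnitary]
  · intro p hp
    simp [cphaseUnitary, Matrix.diagonal_apply_ne' _ hp]

theorem inv_sqrt_two_mul_self : ((√2 : ℝ) : ℂ)⁻¹ * ((√2 : ℝ) : ℂ)⁻¹ = 1 / 2 := by
  rw [← mul_inv, ← Complex.ofReal_mul, Real.mul_self_sqrt (by norm_num)]
  norm_num

/-- The phase gate `diag (1, s)`, followed by the Hadamard gate. -/
def hadamardUnitary (s : unitary ℂ) : Matrix.unitaryGroup Bool ℂ :=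
  ⟨Matrix.of fun p q => ((√2 : ℝ) : ℂ)⁻¹ * if q then (if p then -(s : ℂ) else s) else 1, by
    rw [Matrix.mem_unitaryGroup_iff]
    have h1 := Unitary.mul_star_self_of_mem s.2
    have h2 := inv_sqrt_two_mul_self
    have h3 : (starRingEnd ℂ) ((√2 : ℝ) : ℂ) = ((√2 : ℝ) : ℂ) := Complex.conj_ofReal _
    rw [Complex.star_def] at h1
    ext p q
    rw [Matrix.mul_apply, Fintype.sum_bool]
    cases p <;> cases q <;> simp [Matrix.star_apply, h3] <;>
      generalize ((√2 : ℝ) : ℂ)⁻¹ = r at h2 <;> generalize (starRingEnd ℂ) (s : ℂ) = t at h1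
    · linear_combination 2 * h2 + r * r * h1
    · linear_combination -r * r * h1
    · linear_combination -r * r * h1
    · linear_combination 2 * h2 + r * r * h1⟩

theorem hadamardGate_mulVec {n : ℕ} (a : Wire n) (ψ : (Wire n → Bool) → ℂ) (x : Wire n → Bool) :
    (Gate.one a (hadamardUnitary 1)).matrix.mulVec ψ x =
      ((√2 : ℝ) : ℂ)⁻¹ * (ψ (Function.update x a false) +
        (if x a then -1 else 1) * ψ (Function.update x a true)) := by
  rw [Gate.one_mulVec, Fintype.sum_bool]
  simp only [hadamardUnitary, Matrix.of_apply, if_true, Bool.false_eq_true, if_false,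
    OneMemClass.coe_one]
  ring

/-- The phase `i`. -/
def phaseI : unitary ℂ := ⟨Complex.I, by simp [Unitary.mem_iff]⟩

/-- A circuit that swaps `a` and `b` if `c` holds. -/
def fredkin {n : ℕ} {a b c : Wire n} (hab : a ≠ b) (hac : a ≠ c) (hbc : b ≠ c) :
    List (Gate n) :=
  -- The five middle gates multiply by `i ^ (ab + bc - (a ⊕ c) b) = (-1) ^ (abc)`. Conjugation by
  -- Hadamard on `b` makes this a Toffoli gate with target `b`, and conjugation by the controlled
  -- negation of `a` makes it the controlled swap.
  [cnotGate hab, .one b (hadamardUnitary 1), cphaseGate hab phaseI, cnotGate hac,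
    cphaseGate hab (star phaseI), cnotGate hac, cphaseGate hbc phaseI,
    .one b (hadamardUnitary 1), cnotGate hab]

/-- Reduces an identity about gates on three wires to a check of the eight values of three bits. -/
theorem exists_three_wire_chart {n : ℕ} {a b c : Wire n} (hab : a ≠ b) (hac : a ≠ c)
    (hbc : b ≠ c) (x : Wire n → Bool) :
    ∃ e : Bool → Bool → Bool → Wire n → Bool, (∀ p q r, e p q r a = p) ∧
      (∀ p q r, e p q r b = q) ∧ (∀ p q r, e p q r c = r) ∧
      (∀ p q r s, Function.update (e p q r) a s = e s q r) ∧
      (∀ p q r s, Function.update (e p q r) b s = e p s r) ∧ e (x a) (x b) (x c) = x := by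
  refine ⟨fun p q r => Function.update (Function.update (Function.update x a p) b q) c r,
    ?_, ?_, ?_, ?_, ?_, ?_⟩
  · simp [hab, hac]
  · simp [hbc]
  · simp
  · intro p q r s
    dsimp only
    rw [Function.update_comm hac.symm, Function.update_comm hab.symm, Function.update_idem]
  · intro p q r s
    dsimp only
    rw [Function.update_comm hbc.symm, Function.update_idem]
  · simp

theorem fredkin_mulVec {n : ℕ} {a b c : Wire n} (hab : a ≠ b) (hac : a ≠ c) (hbc : b ≠ c)
    (ψ : (Wire n → Bool) → ℂ) (x : Wire n → Bool) :
    (circuitMatrix (fredkin hab hac hbc)).mulVec ψ x =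
      ψ (if x c then Function.update (Function.update x a (x b)) b (x a) else x) := by
  obtain ⟨e, ha, hb, hc, hua, hub, hx⟩ := exists_three_wire_chart hab hac hbc x
  rw [← hx]
  have h2 := inv_sqrt_two_mul_self
  have hI : Complex.I * Complex.I = -1 := Complex.I_mul_I
  simp only [fredkin, circuitMatrix_cons_mulVec]
  simp only [circuitMatrix, Matrix.one_mulVec, cnotGate_mulVec, hadamardGate_mulVec, cphaseGate_mulVec,
    ha, hb, hc, hua, hub, phaseI]
  generalize ((√2 : ℝ) : ℂ)⁻¹ = r at h2
  generalize x a = p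
  generalize x b = q
  generalize x c = t
  cases p <;> cases q <;> cases t <;> simp <;> ring_nf <;>
    simp [show r ^ 2 = 1 / 2 by rw [sq, h2]] <;> ring

/-- A circuit that swaps the two qudits if the qubit holds. -/
def cswapCircuit (n : ℕ) (l : List (Fin n)) : List (Gate n) :=
  l.flatMap fun i => fredkin (a := .inl i) (b := .inr (.inl i)) (c := .inr (.inr ()))
    (by simp) (by simp) (by simp)

theorem length_cswapCircuit (n : ℕ) (l : List (Fin n)) :
    (cswapCircuit n l).length = 9 * l.length := by
  induction l with
  | nil => rfl
  | cons i l ih =>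
    rw [cswapCircuit, List.flatMap_cons, List.length_append, ← cswapCircuit, ih]
    simp [fredkin]
    ring

/-- The exchange of the `i`-th bits of the two qudits for all `i ∈ l`, if the qubit holds. -/
def swapBits {n : ℕ} (l : List (Fin n)) (x : Wire n → Bool) : Wire n → Bool
  | .inl i => if x (.inr (.inr ())) ∧ i ∈ l then x (.inr (.inl i)) else x (.inl i)
  | .inr (.inl i) => if x (.inr (.inr ())) ∧ i ∈ l then x (.inl i) else x (.inr (.inl i))
  | .inr (.inr _) => x (.inr (.inr ()))

theorem cswapCircuit_mulVec {n : ℕ} {l : List (Fin n)} (hl : l.Nodup)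
    (ψ : (Wire n → Bool) → ℂ) (x : Wire n → Bool) :
    (circuitMatrix (cswapCircuit n l)).mulVec ψ x = ψ (swapBits l x) := by
  induction l generalizing ψ with
  | nil =>
    simp only [cswapCircuit, List.flatMap_nil, circuitMatrix, Matrix.one_mulVec]
    congr 1
    ext (i | i | i) <;> simp [swapBits]
  | cons i l ih =>
    rw [List.nodup_cons] at hl
    rw [cswapCircuit, List.flatMap_cons, circuitMatrix_append, ← cswapCircuit,
      ← Matrix.mulVec_mulVec, ih hl.2, fredkin_mulVec]
    congr 1
    have hi := hl.1
    by_cases hc : x (.inr (.inr ()))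
    · ext (j | j | j)
      · by_cases hj : j = i
        · subst hj; simp [swapBits, hc, hi]
        · simp [swapBits, hc, hj]
      · by_cases hj : j = i
        · subst hj; simp [swapBits, hc, hi]
        · simp [swapBits, hc, hj]
      · simp [swapBits, hc]
    · ext (j | j | j) <;> simp [swapBits, hc]

/-! ### Binary encoding, and the operations realized by the circuits. -/

theorem testBit_injective {d : ℕ} {i j : Fin d}
    (h : ∀ k : Fin (quditBits d), Nat.testBit i k = Nat.testBit j k) : i = j := by
  apply Fin.ext
  apply Nat.eq_of_testBit_eq
  intro k
  by_cases hk : k < quditBits d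
  · exact h ⟨k, hk⟩
  · have hd : d ≤ 2 ^ k := (Nat.le_pow_clog (by norm_num) d).trans
      (Nat.pow_le_pow_right (by norm_num) (not_lt.mp hk))
    rw [Nat.testBit_lt_two_pow (i.2.trans_le hd), Nat.testBit_lt_two_pow (j.2.trans_le hd)]

theorem encode_injective (d : ℕ) : Function.Injective (encode (d := d)) := by
  rintro ⟨i, j, b⟩ ⟨i', j', b'⟩ h
  have h1 : i = i' := testBit_injective fun k => congrFun h (.inl k)
  have h2 : j = j' := testBit_injective fun k => congrFun h (.inr (.inl k))
  have h3 : b = b' := congrFun h (.inr (.inr ()))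
  rw [h1, h2, h3]

/-- The controlled exchange of two qudits on labels of basis states. -/
def cswapLabel {d : ℕ} (x : Basis d) : Basis d :=
  if x.2.2 then (x.2.1, x.1, x.2.2) else x

theorem cswapLabel_cswapLabel {d : ℕ} (x : Basis d) : cswapLabel (cswapLabel x) = x := by
  obtain ⟨i, j, b⟩ := x
  cases b <;> simp [cswapLabel]

theorem swapBits_encode {d : ℕ} (x : Basis d) :
    swapBits (List.finRange (quditBits d)) (encode x) = encode (cswapLabel x) := by
  obtain ⟨i, j, b⟩ := x
  cases b <;> ext (k | k | k) <;> simp [swapBits, encode, cswapLabel]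

/-- Exchange the two qudits if the qubit holds. -/
def cswapOp (d : ℕ) : GateOp d where
  op := ⟨Matrix.of fun x y => if y = cswapLabel x then 1 else 0, by
    rw [Matrix.mem_unitaryGroup_iff]
    ext x y
    rw [Matrix.mul_apply, Fintype.sum_eq_single (cswapLabel x)]
    · have : cswapLabel x = cswapLabel y ↔ x = y :=
        (Function.LeftInverse.injective cswapLabel_cswapLabel).eq_iff
      by_cases h : x = y <;> simp [Matrix.star_apply, Matrix.one_apply, this, h]
    · intro z hz
      simp [hz]⟩
  circuit := cswapCircuit _ (List.finRange (quditBits d))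
  spec x y := by
    have h := cswapCircuit_mulVec (List.nodup_finRange (quditBits d)) (Pi.single (encode y) 1)
      (encode x)
    rw [Matrix.mulVec_single_one, swapBits_encode] at h
    change circuitMatrix _ (encode x) (encode y) = _ at h
    rw [h, Pi.single_apply]
    simp only [(encode_injective d).eq_iff, Matrix.of_apply, eq_comm]

theorem cswapOp_mulVec {d : ℕ} (ψ : Basis d → ℂ) (x : Basis d) :
    ((cswapOp d).op : Matrix (Basis d) (Basis d) ℂ).mulVec ψ x = ψ (cswapLabel x) := by
  change ∑ y, (if y = cswapLabel x then 1 else 0) * ψ y = _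
  simp

/-- A unitary operation on the qubit. -/
def qubitOp (d : ℕ) (U : Matrix.unitaryGroup Bool ℂ) : GateOp d where
  op := ⟨(1 : Matrix (Fin d) (Fin d) ℂ) ⊗ₖ ((1 : Matrix (Fin d) (Fin d) ℂ) ⊗ₖ
      (U : Matrix Bool Bool ℂ)),
    Matrix.kronecker_mem_unitary (one_mem _) (Matrix.kronecker_mem_unitary (one_mem _) U.2)⟩
  circuit := [.one (.inr (.inr ())) U]
  spec x y := by
    obtain ⟨i, j, b⟩ := x
    obtain ⟨i', j', b'⟩ := y
    have : (∀ w : Wire (quditBits d), w ≠ .inr (.inr ()) →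
        encode (i, j, b) w = encode (i', j', b') w) ↔ i = i' ∧ j = j' := by
      constructor
      · intro h
        exact ⟨testBit_injective fun k => h (.inl k) (by simp),
          testBit_injective fun k => h (.inr (.inl k)) (by simp)⟩
      · rintro ⟨rfl, rfl⟩ (k | k | k) hk
        · rfl
        · rfl
        · exact absurd rfl hk
    simp only [circuitMatrix, Matrix.one_mul, Gate.matrix, Matrix.of_apply, this,
      Matrix.kroneckerMap_apply, Matrix.one_apply]
    by_cases h1 : i = i' <;> by_cases h2 : j = j' <;> simp [h1, h2, encode]

theorem qubitOp_mulVec {d : ℕ} (U : Matrix.unitaryGroup Bool ℂ) (ψ : Basis d → ℂ)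
    (x : Basis d) :
    ((qubitOp d U).op : Matrix (Basis d) (Basis d) ℂ).mulVec ψ x =
      ∑ b, (U : Matrix Bool Bool ℂ) x.2.2 b * ψ (x.1, x.2.1, b) := by
  symm
  apply Fintype.sum_of_injective (fun b => (x.1, x.2.1, b))
  · intro b b' h
    simpa using h
  · rintro ⟨i, j, b⟩ hy
    have : ¬ (x.1 = i ∧ x.2.1 = j) := by
      rintro ⟨rfl, rfl⟩
      exact hy ⟨b, rfl⟩
    by_cases h1 : x.1 = i
    · have h2 : x.2.1 ≠ j := fun h2 => this ⟨h1, h2⟩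
      simp [qubitOp, Matrix.one_apply, h2]
    · simp [qubitOp, Matrix.one_apply, h1]
  · intro b
    simp [qubitOp]

/-! ### Linearity of output probabilities -/

theorem measured_add {d : ℕ} (r : Register) (l : Level d r) (ρ σ : State d) :
    measured r l (ρ + σ) = measured r l ρ + measured r l σ := by
  ext x y
  simp only [measured, Matrix.of_apply, Matrix.add_apply]
  split_ifs <;> simp

theorem measured_smul {d : ℕ} (r : Register) (l : Level d r) (c : ℝ) (ρ : State d) :
    measured r l (c • ρ) = c • measured r l ρ := by
  ext x y
  simp only [measured, Matrix.of_apply, Matrix.smul_apply]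
  split_ifs <;> simp

theorem prepared_add {d : ℕ} (r : Register) (l : Level d r) (ρ σ : State d) :
    prepared r l (ρ + σ) = prepared r l ρ + prepared r l σ := by
  ext x y
  simp only [prepared, Matrix.of_apply, Matrix.add_apply]
  split_ifs <;> simp [Finset.sum_add_distrib]

theorem prepared_smul {d : ℕ} (r : Register) (l : Level d r) (c : ℝ) (ρ : State d) :
    prepared r l (c • ρ) = c • prepared r l ρ := by
  ext x y
  simp only [prepared, Matrix.of_apply, Matrix.smul_apply]
  split_ifs <;> simp [Finset.mul_sum]

namespace Algorithm

variable {d : ℕ} (Z : Matrix (Fin d) (Fin d) ℂ) (E : Finset ℝ → Prop)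

theorem probFrom_add (p : Algorithm d) (ρ σ : State d) :
    p.probFrom Z E (ρ + σ) = p.probFrom Z E ρ + p.probFrom Z E σ := by
  induction p generalizing ρ σ with
  | output S hS => simp only [probFrom]; split_ifs <;> simp
  | query p ih => simp only [probFrom, Matrix.mul_add, Matrix.add_mul, ih]
  | apply V p ih => simp only [probFrom, Matrix.mul_add, Matrix.add_mul, ih]
  | prepare r l p ih => simp only [probFrom, prepared_add, ih]
  | measure r p ih => simp only [probFrom, measured_add, ih, Finset.sum_add_distrib]
  | random m p ih => simp only [probFrom, ih, Finset.sum_add_distrib, add_div]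

theorem probFrom_smul (p : Algorithm d) (c : ℝ) (ρ : State d) :
    p.probFrom Z E (c • ρ) = c * p.probFrom Z E ρ := by
  induction p generalizing ρ with
  | output S hS => simp only [probFrom]; split_ifs <;> simp
  | query p ih => simp only [probFrom, Matrix.mul_smul, Matrix.smul_mul, ih]
  | apply V p ih => simp only [probFrom, Matrix.mul_smul, Matrix.smul_mul, ih]
  | prepare r l p ih => simp only [probFrom, prepared_smul, ih]
  | measure r p ih => simp only [probFrom, measured_smul, ih, Finset.mul_sum]
  | random m p ih => simp only [probFrom, ih, ← Finset.mul_sum, mul_div_assoc]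

theorem probFrom_zero (p : Algorithm d) : p.probFrom Z E 0 = 0 := by
  simpa using p.probFrom_smul Z E 0 0

theorem probFrom_sum {ι : Type*} (p : Algorithm d) (s : Finset ι) (ρ : ι → State d) :
    p.probFrom Z E (∑ i ∈ s, ρ i) = ∑ i ∈ s, p.probFrom Z E (ρ i) := by
  classical
  induction s using Finset.induction_on with
  | empty => simp [probFrom_zero]
  | insert i s hi ih => rw [Finset.sum_insert hi, Finset.sum_insert hi, probFrom_add, ih]

end Algorithm

/-! ### Pure states -/

/-- The pure state with vector `ψ`. -/
def pureState {d : ℕ} (ψ : Basis d → ℂ) : State d := Matrix.vecMulVec ψ (star ψ)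

theorem mul_pureState_mul {d : ℕ} (M : Matrix (Basis d) (Basis d) ℂ) (ψ : Basis d → ℂ) :
    M * pureState ψ * M.conjTranspose = pureState (M.mulVec ψ) := by
  rw [pureState, pureState, Matrix.mul_vecMulVec, Matrix.vecMulVec_mul, Matrix.star_mulVec]

/-- The vector `u ⊗ v ⊗ (c₀ e₀ + c₁ e₁)`. -/
def prodVec {d : ℕ} (u v : Fin d → ℂ) (c : Bool → ℂ) : Basis d → ℂ :=
  fun x => c x.2.2 * (u x.1 * v x.2.1)

/-- The vector `c₀ u ⊗ v ⊗ e₀ + c₁ v ⊗ u ⊗ e₁`. -/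
def crossVec {d : ℕ} (u v : Fin d → ℂ) (c : Bool → ℂ) : Basis d → ℂ :=
  fun x => c x.2.2 * if x.2.2 then v x.1 * u x.2.1 else u x.1 * v x.2.1

/-- The state `u ⊗ v ⊗ e_b`. -/
def prodState {d : ℕ} (u v : Fin d → ℂ) (b : Bool) : State d :=
  pureState (prodVec u v (Pi.single b 1))

theorem cswapOp_prodVec {d : ℕ} (u v : Fin d → ℂ) (c : Bool → ℂ) :
    ((cswapOp d).op : Matrix (Basis d) (Basis d) ℂ).mulVec (prodVec u v c) = crossVec u v c := by
  ext ⟨i, j, b⟩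
  rw [cswapOp_mulVec]
  cases b <;> simp [cswapLabel, prodVec, crossVec, mul_comm]

theorem cswapOp_crossVec {d : ℕ} (u v : Fin d → ℂ) (c : Bool → ℂ) :
    ((cswapOp d).op : Matrix (Basis d) (Basis d) ℂ).mulVec (crossVec u v c) = prodVec u v c := by
  ext ⟨i, j, b⟩
  rw [cswapOp_mulVec]
  cases b <;> simp [cswapLabel, prodVec, crossVec, mul_comm]

theorem onFirst_mulVec {d : ℕ} (Z : Matrix (Fin d) (Fin d) ℂ) (ψ : Basis d → ℂ) (x : Basis d) :
    (onFirst Z).mulVec ψ x = ∑ i, Z x.1 i * ψ (i, x.2) := by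
  symm
  apply Fintype.sum_of_injective (fun i => (i, x.2))
  · intro i j h
    simpa using h
  · rintro ⟨i, y⟩ hy
    have : x.2 ≠ y := by
      rintro rfl
      exact hy ⟨i, rfl⟩
    simp [onFirst, this]
  · intro i
    simp [onFirst]

/-- In `crossVec` the qubit decides which eigenvector sits in the first qudit, so an uncontrolled
query acts as a phase gate on the qubit. -/
theorem onFirst_crossVec {d : ℕ} {Z : Matrix (Fin d) (Fin d) ℂ} {u v : Fin d → ℂ} {μ ν : ℂ}
    (hu : Z.mulVec u = μ • u) (hv : Z.mulVec v = ν • v) (c : Bool → ℂ) :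
    (onFirst Z).mulVec (crossVec u v c) =
      crossVec u v (fun b => (if b then ν else μ) * c b) := by
  ext ⟨i, j, b⟩
  rw [onFirst_mulVec]
  have hu' := congrFun hu i
  have hv' := congrFun hv i
  simp only [Matrix.mulVec, dotProduct, Pi.smul_apply, smul_eq_mul] at hu' hv'
  cases b
  · simp only [crossVec, Bool.false_eq_true, if_false]
    calc _ = c false * v j * ∑ k, Z i k * u k := by
            rw [Finset.mul_sum]; exact Finset.sum_congr rfl fun k _ => by ring
      _ = _ := by rw [hu']; ring
  · simp only [crossVec, if_true]
    calc _ = c true * u j * ∑ k, Z i k * v k := by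
            rw [Finset.mul_sum]; exact Finset.sum_congr rfl fun k _ => by ring
      _ = _ := by rw [hv']; ring

theorem hadamardOp_prodVec {d : ℕ} (s : unitary ℂ) (u v : Fin d → ℂ) (c : Bool → ℂ) :
    ((qubitOp d (hadamardUnitary s)).op : Matrix (Basis d) (Basis d) ℂ).mulVec (prodVec u v c) =
      prodVec u v (fun b => ((√2 : ℝ) : ℂ)⁻¹ * (c false + (if b then -(s : ℂ) else s) * c true)) := by
  ext ⟨i, j, b⟩
  rw [qubitOp_mulVec, Fintype.sum_bool]
  simp only [hadamardUnitary, Matrix.of_apply, prodVec, if_true, Bool.false_eq_true, if_false]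
  ring

theorem measured_prodVec {d : ℕ} (u v : Fin d → ℂ) (c : Bool → ℂ) (b : Bool) :
    measured .qubit b (pureState (prodVec u v c)) =
      Complex.normSq (c b) • prodState u v b := by
  ext ⟨i, j, b₁⟩ ⟨i', j', b₂⟩
  have hc : c b * (starRingEnd ℂ) (c b) = Complex.normSq (c b) := Complex.mul_conj _
  simp only [measured, get, Matrix.of_apply, prodState, pureState, Matrix.smul_apply,
    Matrix.vecMulVec_apply, Pi.star_apply, prodVec]
  by_cases h1 : b₁ = b
  · by_cases h2 : b₂ = b
    · subst h1 h2
      simp [← hc]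
      ring
    · simp [h2]
  · simp [h1]

theorem prepared_qubit_prodState {d : ℕ} (u v : Fin d → ℂ) (b b' : Bool) :
    prepared .qubit b' (prodState u v b) = prodState u v b' := by
  ext ⟨i, j, b₁⟩ ⟨i', j', b₂⟩
  simp only [prepared, get, put, Matrix.of_apply, prodState, pureState,
    Matrix.vecMulVec_apply, Pi.star_apply, prodVec]
  change (if _ then ∑ k : Bool, _ else _) = _
  rw [Fintype.sum_bool]
  by_cases h1 : b₁ = b'
  · by_cases h2 : b₂ = b'
    · subst h1 h2
      cases b <;> simp
    · simp [h2]
  · simp [h1]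

/-- Both sides carry the identity in the second register, resolved in the computational basis or in
the eigenbasis. The discarded `w` enters only through its norm. -/
theorem sum_prepared_second {d : ℕ} {Z : Matrix (Fin d) (Fin d) ℂ} {v : Fin d → Fin d → ℂ}
    {θ : Fin d → ℝ} (h : IsEigenbasis Z v θ) (u : Fin d → ℂ) {w : Fin d → ℂ}
    (hw : ∑ i, star (w i) * w i = 1) (b : Bool) :
    ∑ l : Fin d, prepared .second l (prodState u w b) = ∑ a, prodState u (v a) b := by
  ext ⟨i, j, b₁⟩ ⟨i', j', b₂⟩
  simp only [Matrix.sum_apply, prepared, get, put, Matrix.of_apply, prodState, pureState,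
    Matrix.vecMulVec_apply, Pi.star_apply, prodVec]
  set e : Bool → ℂ := Pi.single b 1
  have h1 : ∑ a, e b₁ * (u i * v a j) * star (e b₂ * (u i' * v a j')) =
      e b₁ * u i * star (e b₂ * u i') * if j = j' then 1 else 0 := by
    rw [← h.complete j j', Finset.mul_sum]
    refine Finset.sum_congr rfl fun a _ => ?_
    simp only [star_mul']
    ring
  have h2 : ∑ k : Fin d, e b₁ * (u i * w k) * star (e b₂ * (u i' * w k)) =
      e b₁ * u i * star (e b₂ * u i') := by
    rw [← mul_one (e b₁ * u i * star (e b₂ * u i')), ← hw, Finset.mul_sum]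
    refine Finset.sum_congr rfl fun a _ => ?_
    simp only [star_mul']
    ring
  rw [h1]
  change ∑ l, (if j = l ∧ j' = l then ∑ k : Fin d, e b₁ * (u i * w k) *
    star (e b₂ * (u i' * w k)) else 0) = _
  rw [h2]
  by_cases hj : j = j'
  · subst hj; simp
  · have : ∀ l, ¬ (j = l ∧ j' = l) := fun l hl => hj (hl.1.trans hl.2.symm)
    simp [hj, this]

theorem sum_prepared_first {d : ℕ} {Z : Matrix (Fin d) (Fin d) ℂ} {v : Fin d → Fin d → ℂ}
    {θ : Fin d → ℝ} (h : IsEigenbasis Z v θ) (u : Fin d → ℂ) {w : Fin d → ℂ}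
    (hw : ∑ i, star (w i) * w i = 1) (b : Bool) :
    ∑ l : Fin d, prepared .first l (prodState w u b) = ∑ a, prodState (v a) u b := by
  ext ⟨i, j, b₁⟩ ⟨i', j', b₂⟩
  simp only [Matrix.sum_apply, prepared, get, put, Matrix.of_apply, prodState, pureState,
    Matrix.vecMulVec_apply, Pi.star_apply, prodVec]
  set e : Bool → ℂ := Pi.single b 1
  have h1 : ∑ a, e b₁ * (v a i * u j) * star (e b₂ * (v a i' * u j')) =
      e b₁ * u j * star (e b₂ * u j') * if i = i' then 1 else 0 := by
    rw [← h.complete i i', Finset.mul_sum]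
    refine Finset.sum_congr rfl fun a _ => ?_
    simp only [star_mul']
    ring
  have h2 : ∑ k : Fin d, e b₁ * (w k * u j) * star (e b₂ * (w k * u j')) =
      e b₁ * u j * star (e b₂ * u j') := by
    rw [← mul_one (e b₁ * u j * star (e b₂ * u j')), ← hw, Finset.mul_sum]
    refine Finset.sum_congr rfl fun a _ => ?_
    simp only [star_mul']
    ring
  rw [h1]
  change ∑ l, (if i = l ∧ i' = l then ∑ k : Fin d, e b₁ * (w k * u j) *
    star (e b₂ * (w k * u j')) else 0) = _
  rw [h2]
  by_cases hi : i = i'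
  · subst hi; simp
  · have : ∀ l, ¬ (i = l ∧ i' = l) := fun l hl => hi (hl.1.trans hl.2.symm)
    simp [hi, this]

theorem trace_prodState {d : ℕ} {u v : Fin d → ℂ} (hu : ∑ i, star (u i) * u i = 1)
    (hv : ∑ i, star (v i) * v i = 1) (b : Bool) : (prodState u v b).trace = 1 := by
  have : ∀ i j, ∑ b' : Bool, (prodState u v b) (i, j, b') (i, j, b') =
      (star (u i) * u i) * (star (v j) * v j) := by
    intro i j
    rw [Fintype.sum_bool]
    cases b <;>
      simp [prodState, pureState, Matrix.vecMulVec_apply, prodVec] <;> ring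
  simp only [Matrix.trace, Matrix.diag_apply, Fintype.sum_prod_type, this, ← Finset.mul_sum, hv,
    mul_one, hu]

theorem initialState_eq (m : ℕ) :
    initialState (m + 1) = prodState (Pi.single 0 1) (Pi.single 0 1) false := by
  ext ⟨i, j, b⟩ ⟨i', j', b'⟩
  simp only [initialState, prodState, pureState, prodVec, Matrix.of_apply,
    Matrix.vecMulVec_apply, Pi.star_apply, Pi.single_apply, Fin.ext_iff, Fin.val_zero]
  by_cases h1 : (i : ℕ) = 0 <;> by_cases h2 : (j : ℕ) = 0 <;> by_cases h3 : (i' : ℕ) = 0 <;>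
    by_cases h4 : (j' : ℕ) = 0 <;> cases b <;> cases b' <;> simp [h1, h2, h3, h4]

/-! ### The Hadamard test -/

/-- Apply the unknown unitary `t` times. -/
def queryPow {d : ℕ} : ℕ → Algorithm d → Algorithm d
  | 0, p => p
  | t + 1, p => .query (queryPow t p)

theorem probFrom_queryPow {d : ℕ} {Z : Matrix (Fin d) (Fin d) ℂ} (E : Finset ℝ → Prop)
    {u v : Fin d → ℂ} {μ ν : ℂ} (hu : Z.mulVec u = μ • u) (hv : Z.mulVec v = ν • v)
    (t : ℕ) (p : Algorithm d) (c : Bool → ℂ) :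
    (queryPow t p).probFrom Z E (pureState (crossVec u v c)) =
      p.probFrom Z E (pureState (crossVec u v (fun b => (if b then ν else μ) ^ t * c b))) := by
  induction t generalizing c with
  | zero => simp [queryPow]
  | succ t ih =>
    simp only [queryPow, Algorithm.probFrom, mul_pureState_mul, onFirst_crossVec hu hv, ih]
    simp only [pow_succ, mul_assoc]

/-- One step of phase estimation on the ratio of the eigenvalues of the contents of the two
qudits, with the power `t` of the unknown unitary. The phase `s` selects the cosine or the sine
of the phase of the ratio. -/
def hadamardTest {d : ℕ} (s : unitary ℂ) (t : ℕ) (next : Bool → Algorithm d) : Algorithm d :=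
  .prepare .qubit false <| .apply (qubitOp d (hadamardUnitary 1)) <| .apply (cswapOp d) <|
    queryPow t <| .apply (cswapOp d) <| .apply (qubitOp d (hadamardUnitary s)) <|
    .measure .qubit next

/-- The value `± 1` of an outcome. -/
def sign (b : Bool) : ℝ := if b then -1 else 1

/-- Without the common unimodular phase `exp (i t x)`, the amplitude is `(1 ± w) / 2` with `|w| =
1`, and `|1 ± w|² / 4 = (1 ± Re w) / 2`. -/
theorem normSq_exp_add (s : unitary ℂ) (t : ℕ) (x y : ℝ) (b : Bool) :
    Complex.normSq (((√2 : ℝ) : ℂ)⁻¹ * (Complex.exp (x * Complex.I) ^ t * ((√2 : ℝ) : ℂ)⁻¹ +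
      (if b then -(s : ℂ) else s) * (Complex.exp (y * Complex.I) ^ t * ((√2 : ℝ) : ℂ)⁻¹))) =
      (1 + sign b * ((s : ℂ) * Complex.exp ((t * (y - x) : ℝ) * Complex.I)).re) / 2 := by
  have h1 : ∀ z : ℝ, Complex.normSq (Complex.exp (z * Complex.I)) = 1 := by
    intro z
    rw [Complex.normSq_eq_norm_sq, Complex.norm_exp_ofReal_mul_I, one_pow]
  have hs : Complex.normSq (s : ℂ) = 1 := by
    have := Unitary.mul_star_self_of_mem s.2
    rw [Complex.star_def, Complex.mul_conj] at this
    exact_mod_cast this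
  have hy : Complex.exp (y * Complex.I) ^ t =
      Complex.exp (x * Complex.I) ^ t * Complex.exp ((t * (y - x) : ℝ) * Complex.I) := by
    rw [← Complex.exp_nat_mul, ← Complex.exp_nat_mul, ← Complex.exp_add]
    congr 1
    push_cast
    ring
  set w := (s : ℂ) * Complex.exp ((t * (y - x) : ℝ) * Complex.I)
  have hw : Complex.normSq w = 1 := by rw [Complex.normSq_mul, hs, h1, one_mul]
  have e : ((√2 : ℝ) : ℂ)⁻¹ * (Complex.exp (x * Complex.I) ^ t * ((√2 : ℝ) : ℂ)⁻¹ +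
      (if b then -(s : ℂ) else s) * (Complex.exp (y * Complex.I) ^ t * ((√2 : ℝ) : ℂ)⁻¹)) =
      (1 / 2) * (Complex.exp (x * Complex.I) ^ t * (1 + sign b * w)) := by
    rw [← inv_sqrt_two_mul_self, hy]
    cases b <;> simp [sign, w] <;> ring
  rw [e, Complex.normSq_mul, Complex.normSq_mul, map_pow, h1, one_pow, one_mul]
  rw [Complex.normSq_apply] at hw ⊢
  rw [Complex.normSq_apply]
  cases b <;> simp [sign] <;> linear_combination (1 / 4) * hw

/-- Started with `u ⊗ v` in the two qudits, the algorithm `p` outputs a set with property `E`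
with probability at most `c`. -/
def ProbLE {d : ℕ} (Z : Matrix (Fin d) (Fin d) ℂ) (E : Finset ℝ → Prop) (u v : Fin d → ℂ)
    (p : Algorithm d) (c : ℝ) : Prop :=
  ∀ b, p.probFrom Z E (prodState u v b) ≤ c

theorem ProbLE.mono {d : ℕ} {Z : Matrix (Fin d) (Fin d) ℂ} {E : Finset ℝ → Prop}
    {u v : Fin d → ℂ} {p : Algorithm d} {c c' : ℝ} (h : ProbLE Z E u v p c) (hc : c ≤ c') :
    ProbLE Z E u v p c' :=
  fun b => (h b).trans hc

/-- The second controlled swap disentangles the qubit from the qudits. Each outcome therefore leaves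
`u ⊗ v` unchanged, and successive tests behave as independent coin tosses. -/
theorem probLE_hadamardTest {d : ℕ} {Z : Matrix (Fin d) (Fin d) ℂ} {E : Finset ℝ → Prop}
    {u v : Fin d → ℂ} {x y : ℝ} (hu : Z.mulVec u = Complex.exp (x * Complex.I) • u)
    (hv : Z.mulVec v = Complex.exp (y * Complex.I) • v) (s : unitary ℂ) (t : ℕ)
    {next : Bool → Algorithm d} {c : Bool → ℝ} (h : ∀ b, ProbLE Z E u v (next b) (c b)) :
    ProbLE Z E u v (hadamardTest s t next)
      (∑ b, (1 + sign b * ((s : ℂ) * Complex.exp ((t * (y - x) : ℝ) * Complex.I)).re) / 2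
        * c b) := by
  intro b₀
  simp only [hadamardTest, Algorithm.probFrom, prepared_qubit_prodState]
  rw [prodState]
  simp only [mul_pureState_mul, hadamardOp_prodVec, cswapOp_prodVec]
  rw [probFrom_queryPow E hu hv]
  simp only [Algorithm.probFrom, mul_pureState_mul, hadamardOp_prodVec, cswapOp_crossVec]
  change ∑ b : Bool, _ ≤ _
  refine Finset.sum_le_sum fun b _ => ?_
  rw [measured_prodVec, Algorithm.probFrom_smul]
  simp only [Pi.single_apply, if_true, Bool.false_eq_true, if_false, Bool.true_eq_false,
    mul_zero, add_zero, mul_one]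
  rw [normSq_exp_add]
  refine mul_le_mul_of_nonneg_left (h b b) ?_
  rw [← normSq_exp_add]
  exact Complex.normSq_nonneg _

/-! ### Random preparations -/

/-- Replace the second qudit by a maximally mixed one. -/
def refreshSecond {m : ℕ} (p : Algorithm (m + 1)) : Algorithm (m + 1) :=
  .random m fun i => .prepare .second i p

/-- Replace the first qudit by a maximally mixed one. -/
def refreshFirst {m : ℕ} (p : Algorithm (m + 1)) : Algorithm (m + 1) :=
  .random m fun i => .prepare .first i p

theorem probLE_refreshSecond {m : ℕ} {Z : Matrix (Fin (m + 1)) (Fin (m + 1)) ℂ}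
    {E : Finset ℝ → Prop} {v : Fin (m + 1) → Fin (m + 1) → ℂ} {θ : Fin (m + 1) → ℝ}
    (hv : IsEigenbasis Z v θ) (u : Fin (m + 1) → ℂ) {w : Fin (m + 1) → ℂ}
    (hw : ∑ i, star (w i) * w i = 1) {p : Algorithm (m + 1)} {c : Fin (m + 1) → ℝ}
    (h : ∀ b, ProbLE Z E u (v b) p (c b)) :
    ProbLE Z E u w (refreshSecond p) ((∑ b, c b) / (m + 1 : ℝ)) := by
  intro β
  simp only [refreshSecond, Algorithm.probFrom]
  rw [← Algorithm.probFrom_sum, sum_prepared_second hv u hw, Algorithm.probFrom_sum]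
  gcongr with b
  exact h b β

theorem probLE_refreshFirst {m : ℕ} {Z : Matrix (Fin (m + 1)) (Fin (m + 1)) ℂ}
    {E : Finset ℝ → Prop} {v : Fin (m + 1) → Fin (m + 1) → ℂ} {θ : Fin (m + 1) → ℝ}
    (hv : IsEigenbasis Z v θ) (u : Fin (m + 1) → ℂ) {w : Fin (m + 1) → ℂ}
    (hw : ∑ i, star (w i) * w i = 1) {p : Algorithm (m + 1)} {c : ℝ}
    (h : ∀ a, ProbLE Z E (v a) u p c) :
    ProbLE Z E w u (refreshFirst p) c := by
  intro β
  simp only [refreshFirst, Algorithm.probFrom]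
  rw [← Algorithm.probFrom_sum, sum_prepared_first hv u hw, Algorithm.probFrom_sum,
    div_le_iff₀ (by positivity)]
  calc _ ≤ ∑ _a : Fin (m + 1), c := Finset.sum_le_sum fun a _ => h a β
    _ = _ := by simp [mul_comm]

/-! ### Phases from trigonometric data -/

theorem abs_le_pi_div_three {z : ℝ} (hz : |z| ≤ Real.pi) (h : 1 / 2 ≤ Real.cos z) :
    |z| ≤ Real.pi / 3 := by
  by_contra! hlt
  have := Real.cos_lt_cos_of_nonneg_of_le_pi (by positivity) hz hlt
  rw [Real.cos_abs, Real.cos_pi_div_three] at this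
  linarith

/-- Let `y` represent `x` in `[-π, π]`. If `|2 ^ j y| ≤ π / 3`, then `2 ^ (j + 1) y` is still within
`[-π, π]`, where a cosine of at least `1 / 2` forces the bound `π / 3` again. So no ambiguity modulo
`2π` arises from doubling. -/
theorem norm_coe_le_of_cos {x : ℝ} {J : ℕ} (h : ∀ j < J + 1, 1 / 2 ≤ Real.cos (2 ^ j * x)) :
    ‖(x : AddCircle (2 * Real.pi))‖ ≤ Real.pi / 3 / 2 ^ J := by
  have hpi := Real.pi_pos
  have hy := AddCircle.norm_eq (2 * Real.pi) (x := x)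
  have hle := AddCircle.norm_le_half_period (2 * Real.pi) Real.two_pi_pos.ne'
    (x := (x : AddCircle (2 * Real.pi)))
  rw [hy] at hle ⊢
  rw [abs_of_pos Real.two_pi_pos, mul_div_cancel_left₀ _ two_ne_zero] at hle
  generalize hk : round ((2 * Real.pi)⁻¹ * x) = k at hle
  set y := x - k * (2 * Real.pi)
  have hcos : ∀ j < J + 1, 1 / 2 ≤ Real.cos (2 ^ j * y) := by
    intro j hj
    have e : (2 : ℝ) ^ j * y = 2 ^ j * x - ((2 ^ j * k : ℤ) : ℝ) * (2 * Real.pi) := by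
      simp only [y]; push_cast; ring
    rw [e, Real.cos_sub_int_mul_two_pi]
    exact h j hj
  have main : ∀ j < J + 1, |2 ^ j * y| ≤ Real.pi / 3 := by
    intro j
    induction j with
    | zero =>
      intro hj
      refine abs_le_pi_div_three ?_ (hcos 0 hj)
      simpa using hle
    | succ j ih =>
      intro hj
      refine abs_le_pi_div_three ?_ (hcos _ hj)
      have h1 := ih (by omega)
      have h2 : |2 ^ (j + 1) * y| = 2 * |2 ^ j * y| := by
        rw [pow_succ', mul_assoc, abs_mul]; norm_num
      rw [h2]
      linarith
  have := main J (by omega)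
  rw [abs_mul, abs_of_pos (by positivity)] at this
  rw [le_div_iff₀ (by positivity)]
  linarith

/-- The cosines differ by at most `2 / 3`, and so do the sines; `cos (x - y)` is one minus half the
sum of the squared differences, hence at least `5 / 9`. -/
theorem half_le_cos_sub {m c c' x y : ℝ} (hm : 0 < m) (hx : |c - m * Real.cos x| ≤ m / 3)
    (hx' : |c' - m * Real.sin x| ≤ m / 3) (hy : |c - m * Real.cos y| ≤ m / 3)
    (hy' : |c' - m * Real.sin y| ≤ m / 3) : 1 / 2 ≤ Real.cos (x - y) := by
  rw [abs_le] at hx hx' hy hy'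
  have h1 : |Real.cos x - Real.cos y| ≤ 2 / 3 := by
    rw [abs_le]; constructor <;> nlinarith
  have h2 : |Real.sin x - Real.sin y| ≤ 2 / 3 := by
    rw [abs_le]; constructor <;> nlinarith
  have h3 := sq_le_sq' (abs_le.mp h1).1 (abs_le.mp h1).2
  have h4 := sq_le_sq' (abs_le.mp h2).1 (abs_le.mp h2).2
  rw [Real.cos_sub]
  nlinarith [Real.sin_sq_add_cos_sq x, Real.sin_sq_add_cos_sq y]

/-! ### Indicators -/

open Classical in
/-- The indicator of a proposition. -/
def ind (P : Prop) : ℝ := if P then 1 else 0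

theorem ind_true {P : Prop} (h : P) : ind P = 1 := if_pos h

theorem ind_false {P : Prop} (h : ¬ P) : ind P = 0 := if_neg h

theorem ind_nonneg (P : Prop) : 0 ≤ ind P := by
  by_cases h : P
  · simp [ind_true h]
  · simp [ind_false h]

theorem ind_le_one (P : Prop) : ind P ≤ 1 := by
  by_cases h : P
  · simp [ind_true h]
  · simp [ind_false h]

theorem ind_mono {P Q : Prop} (h : P → Q) : ind P ≤ ind Q := by
  by_cases hP : P
  · rw [ind_true hP, ind_true (h hP)]
  · rw [ind_false hP]; exact ind_nonneg Q

theorem ind_or_le (P Q : Prop) : ind (P ∨ Q) ≤ ind P + ind Q := by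
  by_cases hP : P
  · rw [ind_true hP]; linarith [ind_le_one (P ∨ Q), ind_nonneg Q]
  · rw [ind_false hP, zero_add]
    exact ind_mono (by tauto)

/-! ### Repeated tests -/

/-- This is the exponential moment of a `± 1` variable of mean `q`. After centring, `exp z ≤ 1 + z +
z²` applies since `|r| ≤ 1 / 2`; the linear terms cancel and the variance is `1 - q² ≤ 1`. -/
theorem exp_moment_le {q r : ℝ} (hq : |q| ≤ 1) (hr : |r| ≤ 1 / 2) :
    (1 + q) / 2 * Real.exp r + (1 - q) / 2 * Real.exp (-r) ≤ Real.exp (r * q + r ^ 2) := by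
  have key : ∀ z : ℝ, |z| ≤ 1 → Real.exp z ≤ 1 + z + z ^ 2 := by
    intro z hz
    have := (abs_le.mp (Real.abs_exp_sub_one_sub_id_le hz)).2
    linarith
  obtain ⟨hq1, hq2⟩ := abs_le.mp hq
  have ha : |r * (1 - q)| ≤ 1 := by
    rw [abs_mul, abs_of_nonneg (by linarith : 0 ≤ 1 - q)]
    nlinarith [abs_nonneg r]
  have hb : |-(r * (1 + q))| ≤ 1 := by
    rw [abs_neg, abs_mul, abs_of_nonneg (by linarith : 0 ≤ 1 + q)]
    nlinarith [abs_nonneg r]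
  have h1 := mul_le_mul_of_nonneg_left (key _ ha) (by linarith : 0 ≤ (1 + q) / 2)
  have h2 := mul_le_mul_of_nonneg_left (key _ hb) (by linarith : 0 ≤ (1 - q) / 2)
  have h3 : (1 + q) / 2 * Real.exp (r * (1 - q)) + (1 - q) / 2 * Real.exp (-(r * (1 + q))) ≤
      Real.exp (r ^ 2) := by
    have h4 := Real.add_one_le_exp (r ^ 2)
    nlinarith [mul_nonneg (sq_nonneg r) (sq_nonneg q)]
  have e1 : Real.exp r = Real.exp (r * q) * Real.exp (r * (1 - q)) := by
    rw [← Real.exp_add]; congr 1; ring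
  have e2 : Real.exp (-r) = Real.exp (r * q) * Real.exp (-(r * (1 + q))) := by
    rw [← Real.exp_add]; congr 1; ring
  rw [e1, e2, Real.exp_add]
  calc _ = Real.exp (r * q) * ((1 + q) / 2 * Real.exp (r * (1 - q)) +
        (1 - q) / 2 * Real.exp (-(r * (1 + q)))) := by ring
    _ ≤ _ := mul_le_mul_of_nonneg_left h3 (Real.exp_nonneg _)

/-- Perform `m` Hadamard tests, and add the outcomes `± 1` to the counter. -/
def repeatTest {d : ℕ} (s : unitary ℂ) (t : ℕ) : ℕ → ℝ → (ℝ → Algorithm d) → Algorithm d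
  | 0, n, next => next n
  | m + 1, n, next => hadamardTest s t fun b => repeatTest s t m (n + sign b) next

/-- Two eigenvectors `u` and `v` of `Z` the eigenvalues of which differ by the phase `ω`. -/
structure IsEigenpair {d : ℕ} (Z : Matrix (Fin d) (Fin d) ℂ) (u v : Fin d → ℂ) (ω : ℝ) :
    Prop where
  exists_phases : ∃ (x y : ℝ) (k : ℤ), Z.mulVec u = Complex.exp (x * Complex.I) • u ∧
    Z.mulVec v = Complex.exp (y * Complex.I) • v ∧ y - x = ω + k * (2 * Real.pi)

/-- The expectation of the outcome `± 1` of a Hadamard test. -/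
def testMean (s : unitary ℂ) (x : ℝ) : ℝ := ((s : ℂ) * Complex.exp (x * Complex.I)).re

theorem abs_testMean_le (s : unitary ℂ) (x : ℝ) : |testMean s x| ≤ 1 := by
  refine (Complex.abs_re_le_norm _).trans ?_
  rw [norm_mul, Complex.norm_exp_ofReal_mul_I, mul_one]
  exact (CStarRing.norm_of_mem_unitary s.2).le

section

variable {d : ℕ} {Z : Matrix (Fin d) (Fin d) ℂ} {E : Finset ℝ → Prop} {u v : Fin d → ℂ} {ω : ℝ}

theorem IsEigenpair.probLE_hadamardTest (h : IsEigenpair Z u v ω) (s : unitary ℂ) (t : ℕ)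
    {next : Bool → Algorithm d} {c : Bool → ℝ} (hc : ∀ b, ProbLE Z E u v (next b) (c b)) :
    ProbLE Z E u v (hadamardTest s t next)
      ((1 + testMean s (t * ω)) / 2 * c false + (1 - testMean s (t * ω)) / 2 * c true) := by
  obtain ⟨x, y, k, hu, hv, hω⟩ := h.exists_phases
  have hmean : ((s : ℂ) * Complex.exp ((t * (y - x) : ℝ) * Complex.I)).re =
      testMean s (t * ω) := by
    have : ((t * (y - x) : ℝ) : ℂ) * Complex.I =
        ((t * ω : ℝ) : ℂ) * Complex.I + ((t * k : ℤ) : ℂ) * (2 * Real.pi * Complex.I) := by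
      rw [hω]; push_cast; ring
    rw [this, Complex.exp_add, Complex.exp_int_mul_two_pi_mul_I, mul_one, testMean]
  refine (EigenphaseEstimation.probLE_hadamardTest hu hv s t hc).mono (le_of_eq ?_)
  rw [Fintype.sum_bool, hmean]
  simp only [sign, if_true, Bool.false_eq_true, if_false]
  ring

/-- The Chernoff method as a potential: the weights with exponents `r` and `-r` watch the two tails,
and each test multiplies them by at most the factor of `exp_moment_le`. -/
theorem IsEigenpair.probLE_repeatTest_exp (h : IsEigenpair Z u v ω) (s : unitary ℂ) (t : ℕ)
    {A B r a b : ℝ} (hB : 0 ≤ B) (hr : |r| ≤ 1 / 2) {next : ℝ → Algorithm d}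
    (hnext : ∀ n, ProbLE Z E u v (next n)
      (A + B * (Real.exp (r * (n - a)) + Real.exp (-r * (n - b))))) (m : ℕ) (n : ℝ) :
    ProbLE Z E u v (repeatTest s t m n next)
      (A + B * (Real.exp (r * (n - a) + m * (r * testMean s (t * ω) + r ^ 2)) +
        Real.exp (-r * (n - b) + m * (-r * testMean s (t * ω) + r ^ 2)))) := by
  induction m generalizing n with
  | zero => simpa [repeatTest] using hnext n
  | succ m ih =>
    refine (h.probLE_hadamardTest s t fun b => ih (n + sign b)).mono ?_
    set q := testMean s (t * ω)
    have hq : |q| ≤ 1 := abs_testMean_le _ _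
    have h1 := exp_moment_le hq hr
    have h2 := exp_moment_le hq (r := -r) (by rwa [abs_neg])
    simp only [sign, if_true, Bool.false_eq_true, if_false]
    set X := Real.exp (r * (n - a) + m * (r * q + r ^ 2))
    set Y := Real.exp (-r * (n - b) + m * (-r * q + r ^ 2))
    have e1 : Real.exp (r * (n + 1 - a) + m * (r * q + r ^ 2)) = X * Real.exp r := by
      rw [← Real.exp_add]; congr 1; ring
    have e2 : Real.exp (r * (n + -1 - a) + m * (r * q + r ^ 2)) = X * Real.exp (-r) := by
      rw [← Real.exp_add]; congr 1; ring
    have e3 : Real.exp (-r * (n + 1 - b) + m * (-r * q + r ^ 2)) = Y * Real.exp (-r) := by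
      rw [← Real.exp_add]; congr 1; ring
    have e4 : Real.exp (-r * (n + -1 - b) + m * (-r * q + r ^ 2)) = Y * Real.exp r := by
      rw [← Real.exp_add]; congr 1; ring
    have e5 : Real.exp (r * (n - a) + (m + 1 : ℕ) * (r * q + r ^ 2)) =
        X * Real.exp (r * q + r ^ 2) := by
      rw [← Real.exp_add]; congr 1; push_cast; ring
    have e6 : Real.exp (-r * (n - b) + (m + 1 : ℕ) * (-r * q + r ^ 2)) =
        Y * Real.exp (-r * q + (-r) ^ 2) := by
      rw [← Real.exp_add]; congr 1; push_cast; ring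
    rw [e1, e2, e3, e4, e5, e6]
    rw [neg_neg] at h2
    have h3 := mul_le_mul_of_nonneg_left h1 (mul_nonneg hB (Real.exp_nonneg _ : 0 ≤ X))
    have h4 := mul_le_mul_of_nonneg_left h2 (mul_nonneg hB (Real.exp_nonneg _ : 0 ≤ Y))
    linarith

theorem ind_deviation_le {n m q : ℝ} :
    ind (¬ |n - m * q| ≤ m / 3) ≤ Real.exp (1 / 6 * (n - (m * q + m / 3))) +
      Real.exp (-(1 / 6) * (n - (m * q - m / 3))) := by
  by_cases h : |n - m * q| ≤ m / 3
  · rw [ind_false (not_not.mpr h)]; positivity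
  · rw [ind_true h]
    rw [not_le, lt_abs] at h
    rcases h with h | h
    · have := Real.one_le_exp (x := 1 / 6 * (n - (m * q + m / 3))) (by linarith)
      linarith [Real.exp_nonneg (-(1 / 6) * (n - (m * q - m / 3)))]
    · have := Real.one_le_exp (x := -(1 / 6) * (n - (m * q - m / 3))) (by linarith)
      linarith [Real.exp_nonneg (1 / 6 * (n - (m * q + m / 3)))]

theorem IsEigenpair.probLE_repeatTest (h : IsEigenpair Z u v ω) (s : unitary ℂ) (t M : ℕ)
    {A B : ℝ} (hB : 0 ≤ B) {next : ℝ → Algorithm d}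
    (hnext : ∀ n, ProbLE Z E u v (next n)
      (A + B * ind (¬ |n - (36 * M : ℕ) * testMean s (t * ω)| ≤ (36 * M : ℕ) / 3))) :
    ProbLE Z E u v (repeatTest s t (36 * M) 0 next) (A + B * (2 * (1 / 2) ^ M)) := by
  set q := testMean s (t * ω)
  have h1 := h.probLE_repeatTest_exp s t hB (r := 1 / 6) (by norm_num [abs_of_pos])
    (fun n => (hnext n).mono (add_le_add_right (mul_le_mul_of_nonneg_left ind_deviation_le hB) A))
    (36 * M) 0
  refine h1.mono ?_
  have hexp : Real.exp (-M) ≤ (1 / 2) ^ M := by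
    have h3 : Real.exp (-1) ≤ 1 / 2 := by
      rw [Real.exp_neg, inv_le_comm₀ (Real.exp_pos _) (by norm_num)]
      linarith [Real.add_one_le_exp 1]
    calc Real.exp (-M) = Real.exp (-1) ^ M := by rw [← Real.exp_nat_mul]; ring_nf
      _ ≤ _ := pow_le_pow_left₀ (Real.exp_nonneg _) h3 M
  -- With rate `1 / 6` and tolerance `1 / 3`, each test contributes `-1 / 18 + 1 / 36 = -1 / 36`;
  -- hence blocks of `36` tests.
  have e1 : (1 / 6 : ℝ) * (0 - ((36 * M : ℕ) * q + (36 * M : ℕ) / 3)) +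
      (36 * M : ℕ) * (1 / 6 * q + (1 / 6) ^ 2) = -M := by push_cast; ring
  have e2 : -(1 / 6 : ℝ) * (0 - ((36 * M : ℕ) * q - (36 * M : ℕ) / 3)) +
      (36 * M : ℕ) * (-(1 / 6) * q + (1 / 6) ^ 2) = -M := by push_cast; ring
  rw [e1, e2]
  have := mul_le_mul_of_nonneg_left hexp hB
  linarith

theorem testMean_one (x : ℝ) : testMean 1 x = Real.cos x := by
  simp [testMean, Complex.exp_ofReal_mul_I_re]

theorem testMean_star_phaseI (x : ℝ) : testMean (star phaseI) x = Real.sin x := by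
  simp [testMean, phaseI, Complex.exp_ofReal_mul_I_im]

/-! ### Phase estimation -/

/-- The number of repetitions at precision `2 ^ (-j)`. -/
def reps (K J j : ℕ) : ℕ := 36 * (K + (J - j))

/-- The phases that are consistent with the outcomes of the tests for the powers `2 ^ i` of the
unknown unitary, `i < j`, and belong to `S`. -/
def estimate {d : ℕ} (K J : ℕ) : ℕ → Set ℝ → (Set ℝ → Algorithm d) → Algorithm d
  | 0, S, next => next S
  | j + 1, S, next => repeatTest 1 (2 ^ j) (reps K J j) 0 fun c =>
      repeatTest (star phaseI) (2 ^ j) (reps K J j) 0 fun c' =>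
        estimate K J j (S ∩ {x | |c - reps K J j * Real.cos (2 ^ j * x)| ≤ reps K J j / 3 ∧
          |c' - reps K J j * Real.sin (2 ^ j * x)| ≤ reps K J j / 3}) next

/-- Unless a counter deviates, `ω` stays in the candidate set. The two counters at power `2 ^ j`
deviate with probability at most `4 * 2 ^ (-(K + J - j))`; this equals the error allowed for all
lower powers together, so the allowance doubles with each `j`. -/
theorem IsEigenpair.probLE_estimate (h : IsEigenpair Z u v ω) {K J : ℕ} (hK : 0 < K)
    {A B : ℝ} (hB : 0 ≤ B) {next : Set ℝ → Algorithm d} {j : ℕ} (hj : j ≤ J + 1) {S : Set ℝ}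
    (hnext : ∀ S' ⊆ S, (∀ i < j, ∀ x ∈ S', ∀ y ∈ S', 1 / 2 ≤ Real.cos (2 ^ i * (x - y))) →
      ProbLE Z E u v (next S') (A + B * ind (ω ∉ S'))) :
    ProbLE Z E u v (estimate K J j S next)
      (A + B * (ind (ω ∉ S) + 4 * (1 / 2) ^ K * (2 ^ j / 2 ^ J))) := by
  induction j generalizing S with
  | zero =>
    refine (hnext S le_rfl (by simp)).mono ?_
    have : 0 ≤ B * (4 * (1 / 2 : ℝ) ^ K * (2 ^ 0 / 2 ^ J)) := by positivity
    linarith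
  | succ j ih =>
    have hm : (0 : ℝ) < reps K J j := by
      rw [reps]; exact_mod_cast (by omega)
    have hδ : (1 / 2 : ℝ) ^ (K + (J - j)) = (1 / 2) ^ K * (2 ^ j / 2 ^ J) := by
      have : (2 : ℝ) ^ J = 2 ^ (J - j) * 2 ^ j := by rw [← pow_add]; congr 1; omega
      rw [pow_add, this, one_div_pow (2 : ℝ) (J - j)]
      field_simp
    set δ := 4 * (1 / 2 : ℝ) ^ K * (2 ^ j / 2 ^ J) with hδ_def
    have h1 : ∀ c c' : ℝ, ProbLE Z E u v
        (estimate K J j (S ∩ {x | |c - reps K J j * Real.cos (2 ^ j * x)| ≤ reps K J j / 3 ∧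
          |c' - reps K J j * Real.sin (2 ^ j * x)| ≤ reps K J j / 3}) next)
        ((A + B * (ind (ω ∉ S) + δ) +
          B * ind (¬ |c - reps K J j * testMean 1 ((2 ^ j : ℕ) * ω)| ≤ reps K J j / 3)) +
          B * ind (¬ |c' - reps K J j * testMean (star phaseI) ((2 ^ j : ℕ) * ω)| ≤
            reps K J j / 3)) := by
      intro c c'
      rw [testMean_one, testMean_star_phaseI]
      push_cast
      refine (ih (by omega) fun S' hS' hcos => hnext S' (hS'.trans Set.inter_subset_left)
        fun i hi x hx y hy => ?_).mono ?_
      · rcases Nat.lt_succ_iff_lt_or_eq.mp hi with hi | rfl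
        · exact hcos i hi x hx y hy
        · rw [mul_sub]
          exact half_le_cos_sub hm (hS' hx).2.1 (hS' hx).2.2 (hS' hy).2.1 (hS' hy).2.2
      · have h2 := ind_mono (P := ω ∉ S ∩ {x | |c - reps K J j * Real.cos (2 ^ j * x)| ≤
            reps K J j / 3 ∧ |c' - reps K J j * Real.sin (2 ^ j * x)| ≤ reps K J j / 3})
          (Q := (ω ∉ S ∨ ¬ |c - reps K J j * Real.cos (2 ^ j * ω)| ≤ reps K J j / 3) ∨
            ¬ |c' - reps K J j * Real.sin (2 ^ j * ω)| ≤ reps K J j / 3) (by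
          simp only [Set.mem_inter_iff, Set.mem_ofPred_eq]; tauto)
        have h3 := h2.trans ((ind_or_le _ _).trans (add_le_add_left (ind_or_le _ _) _))
        have h4 := mul_le_mul_of_nonneg_left h3 hB
        linarith
    refine (h.probLE_repeatTest 1 (2 ^ j) _ hB fun c =>
      (h.probLE_repeatTest (star phaseI) (2 ^ j) _ hB fun c' => h1 c c').mono
        (le_of_eq (add_right_comm _ _ _))).mono (le_of_eq ?_)
    rw [hδ, hδ_def, pow_succ]
    ring

end

/-! ### Repeated runs with random eigenvectors. -/

/-- An element of `S` in `[0, 2π)`, if there is any. -/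
def pick (S : Set ℝ) : ℝ :=
  -- The default `0` keeps the output in `[0, 2π)` when the outcomes are inconsistent; then the true
  -- phase was lost too, so this counts as a failed estimate.
  open Classical in if h : (S ∩ Set.Ico 0 (2 * Real.pi)).Nonempty then h.some else 0

theorem pick_mem_Ico (S : Set ℝ) : pick S ∈ Set.Ico 0 (2 * Real.pi) := by
  rw [pick]
  split_ifs with h
  · exact h.some_mem.2
  · exact ⟨le_rfl, Real.two_pi_pos⟩

theorem pick_mem {S : Set ℝ} (h : (S ∩ Set.Ico 0 (2 * Real.pi)).Nonempty) : pick S ∈ S := by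
  rw [pick, dif_pos h]
  exact h.some_mem.1

/-- Finite sets of phases. -/
abbrev PhaseSet : Type := {S : Finset ℝ // (S : Set ℝ) ⊆ Set.Ico 0 (2 * Real.pi)}

/-- Add an element of `A` to the phases found so far. -/
def PhaseSet.insertPick (S : PhaseSet) (A : Set ℝ) : PhaseSet :=
  open Classical in ⟨insert (pick A) S.1, by
    rw [Finset.coe_insert]
    exact Set.insert_subset (pick_mem_Ico A) S.2⟩

theorem PhaseSet.mem_insertPick {S : PhaseSet} {A : Set ℝ} {z : ℝ} :
    z ∈ (S.insertPick A).1 ↔ z = pick A ∨ z ∈ S.1 := by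
  simp [insertPick]

/-- Estimate `n` times the phase of a random eigenvalue relative to the eigenvalue of the
eigenvector in the first qudit. -/
def runs {m : ℕ} (K J : ℕ) : ℕ → PhaseSet → Algorithm (m + 1)
  | 0, S => .output S.1 S.2
  | n + 1, S => refreshSecond (estimate K J (J + 1) (Set.Ico 0 (2 * Real.pi)) fun A =>
      runs K J n (S.insertPick A))

/-- The bound is a potential with `n` runs left: a spurious phase already present, the chance that
an estimate fails in the remaining runs, and for each uncovered `b` the chance that it is never
drawn. -/
theorem probLE_runs {m : ℕ} {Z : Matrix (Fin (m + 1)) (Fin (m + 1)) ℂ}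
    {E : Finset ℝ → Prop} {v : Fin (m + 1) → Fin (m + 1) → ℂ} {θ : Fin (m + 1) → ℝ}
    (hv : IsEigenbasis Z v θ) {u : Fin (m + 1) → ℂ} (hu : ∑ i, star (u i) * u i = 1)
    {ω : Fin (m + 1) → ℝ} (hω : ∀ b, IsEigenpair Z u (v b) (ω b))
    (hω_mem : ∀ b, ω b ∈ Set.Ico 0 (2 * Real.pi)) {K J : ℕ} (hK : 0 < K)
    {near : ℝ → Fin (m + 1) → Prop}
    (hnear : ∀ z b, ‖((z - ω b : ℝ) : AddCircle (2 * Real.pi))‖ ≤ Real.pi / 3 / 2 ^ J → near z b)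
    (hE : ∀ S, E S → (∃ z ∈ S, ∀ b, ¬ near z b) ∨ ∃ b, ∀ z ∈ S, ¬ near z b)
    (n : ℕ) (S : PhaseSet) {w : Fin (m + 1) → ℂ} (hw : ∑ i, star (w i) * w i = 1) :
    ProbLE Z E u w (runs K J n S) (ind (∃ z ∈ S.1, ∀ b, ¬ near z b) + n * (16 * (1 / 2) ^ K) +
      ∑ b, ind (∀ z ∈ S.1, ¬ near z b) * (1 - 1 / (m + 1 : ℝ)) ^ n) := by
  induction n generalizing S w with
  | zero =>
    intro β
    simp only [runs, Algorithm.probFrom, trace_prodState hu hw]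
    have h1 : ind (E S.1) ≤ ind (∃ z ∈ S.1, ∀ b, ¬ near z b) +
        ∑ b, ind (∀ z ∈ S.1, ¬ near z b) := by
      refine (ind_mono (hE S.1)).trans ((ind_or_le _ _).trans (add_le_add_right ?_ _))
      by_cases h : ∃ b, ∀ z ∈ S.1, ¬ near z b
      · rw [ind_true h]
        obtain ⟨b, hb⟩ := h
        rw [← ind_true hb]
        exact Finset.single_le_sum (f := fun b => ind (∀ z ∈ S.1, ¬ near z b))
          (fun b _ => ind_nonneg _) (Finset.mem_univ b)
      · rw [ind_false h]
        exact Finset.sum_nonneg fun b _ => ind_nonneg _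
    simpa [ind] using h1
  | succ n ih =>
    set r : ℝ := 1 - 1 / (m + 1 : ℝ) with hr
    have hr0 : 0 ≤ r := by
      rw [hr, sub_nonneg, div_le_one (by positivity)]
      linarith [Nat.cast_nonneg (α := ℝ) m]
    have hr1 : r ≤ 1 := by
      rw [hr]
      have : (0 : ℝ) ≤ 1 / (m + 1 : ℝ) := by positivity
      linarith
    have hrn : r ^ n ≤ 1 := pow_le_one₀ hr0 hr1
    set X : ℝ := ind (∃ z ∈ S.1, ∀ b, ¬ near z b) + n * (16 * (1 / 2) ^ K) with hX
    set f : Fin (m + 1) → ℝ := fun b => ind (∀ z ∈ S.1, ¬ near z b) * r ^ n with hf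
    have key : ∀ b, ProbLE Z E u (v b)
        (estimate K J (J + 1) (Set.Ico 0 (2 * Real.pi)) fun A => runs K J n (S.insertPick A))
        ((X + (∑ b', f b' - f b)) + 16 * (1 / 2) ^ K) := by
      intro b
      have hvb : ∑ i, star (v b i) * v b i = 1 := by rw [hv.ortho, if_pos rfl]
      -- A successful estimate removes the term of `b`. A failed one costs at most `2`: one for a
      -- spurious phase, one for leaving `b` uncovered.
      refine ((hω b).probLE_estimate (A := X + (∑ b', f b' - f b)) (B := 2) hK (by norm_num)
        le_rfl fun A hA hcos => (ih (S.insertPick A) hvb).mono ?_).mono ?_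
      · have hsum : ∑ b', f b' - f b = ∑ b' ∈ Finset.univ.erase b, f b' := by
          rw [← Finset.add_sum_erase _ _ (Finset.mem_univ b)]; ring
        rw [hsum, ← Finset.add_sum_erase _ _ (Finset.mem_univ b)]
        have h2 : ∑ b' ∈ Finset.univ.erase b, ind (∀ z ∈ (S.insertPick A).1, ¬ near z b') * r ^ n
            ≤ ∑ b' ∈ Finset.univ.erase b, f b' := by
          refine Finset.sum_le_sum fun b' _ => mul_le_mul_of_nonneg_right (ind_mono ?_)
            (pow_nonneg hr0 n)
          intro h z hz
          exact h z (PhaseSet.mem_insertPick.mpr (Or.inr hz))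
        by_cases hωA : ω b ∈ A
        · have hpick : near (pick A) b := by
            apply hnear
            apply norm_coe_le_of_cos
            intro j hj
            exact hcos j hj _ (pick_mem ⟨_, hωA, hω_mem b⟩) _ hωA
          have h3 : ind (∀ z ∈ (S.insertPick A).1, ¬ near z b) = 0 :=
            ind_false fun h => h _ (PhaseSet.mem_insertPick.mpr (Or.inl rfl)) hpick
          have h4 : ind (∃ z ∈ (S.insertPick A).1, ∀ b, ¬ near z b) ≤
              ind (∃ z ∈ S.1, ∀ b, ¬ near z b) := by
            refine ind_mono ?_
            rintro ⟨z, hz, hz'⟩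
            rcases PhaseSet.mem_insertPick.mp hz with rfl | hz
            · exact absurd hpick (hz' b)
            · exact ⟨z, hz, hz'⟩
          rw [h3, ind_false (not_not.mpr hωA)]
          linarith
        · rw [ind_true hωA]
          have h3 := ind_le_one (∃ z ∈ (S.insertPick A).1, ∀ b, ¬ near z b)
          have h4 : ind (∀ z ∈ (S.insertPick A).1, ¬ near z b) * r ^ n ≤ 1 :=
            mul_le_one₀ (ind_le_one _) (pow_nonneg hr0 n) hrn
          have h5 := ind_nonneg (∃ z ∈ S.1, ∀ b, ¬ near z b)
          linarith
      · rw [ind_false (not_not.mpr (hω_mem b)), pow_succ]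
        have : (2 : ℝ) ^ J * 2 / 2 ^ J = 2 := by field_simp
        rw [this]
        linarith
    -- The average of `∑ f - f b` over `b` is `r * ∑ f`, which supplies the additional power of `r`.
    refine (probLE_refreshSecond hv u hw key).mono (le_of_eq ?_)
    have hm : (m + 1 : ℝ) ≠ 0 := by positivity
    have h6 : ∑ b, ind (∀ z ∈ S.1, ¬ near z b) * r ^ (n + 1) = r * ∑ b, f b := by
      rw [Finset.mul_sum]
      exact Finset.sum_congr rfl fun b _ => by rw [hf, pow_succ]; ring
    rw [h6]
    simp only [Finset.sum_add_distrib, Finset.sum_sub_distrib, Finset.sum_const,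
      Finset.card_univ, Fintype.card_fin, nsmul_eq_mul]
    rw [hX, hr]
    push_cast
    field_simp
    ring

/-! ### Costs -/

/-- Bounds for the four costs of an algorithm. -/
structure CostLE {d : ℕ} (p : Algorithm d) (q g c G : ℕ) : Prop where
  queries : p.queries ≤ q
  gates : p.gates ≤ g
  currentRun : p.currentRun ≤ c
  gatesPerRun : p.gatesPerRun ≤ G

section

variable {d q g c G : ℕ} {p : Algorithm d}

theorem CostLE.congr (h : CostLE p q g c G) {q' g' c' : ℕ} (hq : q = q') (hg : g = g')
    (hc : c = c') : CostLE p q' g' c' G := by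
  subst hq hg hc
  exact h

theorem CostLE.query (h : CostLE p q g c G) : CostLE (.query p) (q + 1) g c G where
  queries := Nat.succ_le_succ h.queries
  gates := h.gates
  currentRun := h.currentRun
  gatesPerRun := h.gatesPerRun

theorem CostLE.queryPow (h : CostLE p q g c G) (t : ℕ) : CostLE (queryPow t p) (q + t) g c G := by
  induction t with
  | zero => exact h
  | succ t ih => exact ih.query

theorem CostLE.apply (h : CostLE p q g c G) (V : GateOp d) (hG : c + V.circuit.length ≤ G) :
    CostLE (.apply V p) q (g + V.circuit.length) (c + V.circuit.length) G where
  queries := h.queries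
  gates := Nat.add_le_add_right h.gates _
  currentRun := Nat.add_le_add_right h.currentRun _
  gatesPerRun := max_le ((Nat.add_le_add_right h.currentRun _).trans hG) h.gatesPerRun

theorem CostLE.prepare_qubit (h : CostLE p q g c G) (b : Bool) (hG : c + 1 ≤ G) :
    CostLE (.prepare .qubit b p) q (g + 1) (c + 1) G where
  queries := h.queries
  gates := Nat.add_le_add_right h.gates _
  currentRun := Nat.add_le_add_right h.currentRun _
  gatesPerRun := max_le ((Nat.add_le_add_right h.currentRun _).trans hG) h.gatesPerRun

theorem CostLE.measure_qubit {next : Bool → Algorithm d} (h : ∀ b, CostLE (next b) q g c G)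
    (hG : c + 1 ≤ G) : CostLE (.measure .qubit next) q (g + 1) (c + 1) G where
  queries := Finset.sup_le fun b _ => (h b).queries
  gates := Nat.add_le_add_right (Finset.sup_le fun b _ => (h b).gates) _
  currentRun := Nat.add_le_add_right (Finset.sup_le fun b _ => (h b).currentRun) _
  gatesPerRun := max_le
    ((Nat.add_le_add_right (Finset.sup_le fun b _ => (h b).currentRun) _).trans hG)
    (Finset.sup_le fun b _ => (h b).gatesPerRun)

/-- The number of elementary operations in a Hadamard test. -/
def testGates (d : ℕ) : ℕ := 18 * quditBits d + 4

theorem length_cswapOp_circuit (d : ℕ) : (cswapOp d).circuit.length = 9 * quditBits d := by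
  rw [cswapOp, length_cswapCircuit, List.length_finRange]

theorem CostLE.hadamardTest {next : Bool → Algorithm d} (h : ∀ b, CostLE (next b) q g c G)
    (s : unitary ℂ) (t : ℕ) (hG : c + testGates d ≤ G) :
    CostLE (hadamardTest s t next) (q + t) (g + testGates d) (c + testGates d) G := by
  have hl := length_cswapOp_circuit d
  have hq : ∀ U, (qubitOp d U).circuit.length = 1 := fun U => rfl
  rw [testGates] at hG ⊢
  have h1 := CostLE.measure_qubit h (by omega)
  have h2 := h1.apply (qubitOp d (hadamardUnitary s)) (by rw [hq]; omega)
  have h3 := h2.apply (cswapOp d) (by rw [hl, hq]; omega)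
  have h4 := (h3.queryPow t).apply (cswapOp d) (by rw [hl, hq]; omega)
  have h5 := h4.apply (qubitOp d (hadamardUnitary 1)) (by rw [hl, hq, hq]; omega)
  have h6 := h5.prepare_qubit false (by rw [hl, hq, hq]; omega)
  rw [hl, hq, hq] at h6
  exact h6.congr rfl (by ring) (by ring)

theorem CostLE.repeatTest {next : ℝ → Algorithm d} (h : ∀ n, CostLE (next n) q g c G)
    (s : unitary ℂ) (t m : ℕ) (hG : c + m * testGates d ≤ G) (n : ℝ) :
    CostLE (repeatTest s t m n next) (q + m * t) (g + m * testGates d)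
      (c + m * testGates d) G := by
  induction m generalizing n with
  | zero => simpa [EigenphaseEstimation.repeatTest] using h n
  | succ m ih =>
    rw [Nat.succ_mul] at hG
    have := CostLE.hadamardTest (fun b => ih (by omega) (n + sign b)) s t (by omega)
    exact this.congr (by ring) (by ring) (by ring)

theorem CostLE.estimate {next : Set ℝ → Algorithm d} (h : ∀ S, CostLE (next S) q g c G)
    (K J j : ℕ) (hG : c + (∑ i ∈ Finset.range j, 2 * reps K J i) * testGates d ≤ G)
    (S : Set ℝ) :
    CostLE (estimate K J j S next) (q + ∑ i ∈ Finset.range j, 2 * reps K J i * 2 ^ i)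
      (g + (∑ i ∈ Finset.range j, 2 * reps K J i) * testGates d)
      (c + (∑ i ∈ Finset.range j, 2 * reps K J i) * testGates d) G := by
  induction j generalizing S with
  | zero => simpa [EigenphaseEstimation.estimate] using h S
  | succ j ih =>
    simp only [Finset.sum_range_succ, add_mul] at hG ⊢
    have h1 := CostLE.repeatTest (fun n => CostLE.repeatTest (fun n' => ih (by omega)
      (S ∩ {x | |n - reps K J j * Real.cos (2 ^ j * x)| ≤ reps K J j / 3 ∧
          |n' - reps K J j * Real.sin (2 ^ j * x)| ≤ reps K J j / 3})) (star phaseI) (2 ^ j)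
      (reps K J j) (by rw [mul_assoc 2] at hG; omega) 0) 1 (2 ^ j) (reps K J j)
      (by rw [mul_assoc 2] at hG; omega) 0
    exact h1.congr (by ring) (by ring) (by ring)

/-- The right side is chosen so that the induction step is an equality. At `n = J + 1` only `K + 1`
remains of the linear factor, so `J` enters only through `2 ^ J`. -/
theorem sum_reps_mul_two_pow_le (K J : ℕ) {n : ℕ} (hn : n ≤ J + 1) :
    ∑ j ∈ Finset.range n, 2 * reps K J j * 2 ^ j ≤ 72 * (2 ^ n * (K + (J + 1 - n) + 1)) := by
  induction n with
  | zero => simp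
  | succ n ih =>
    rw [Finset.sum_range_succ]
    obtain ⟨a, rfl⟩ : ∃ a, J = n + a := ⟨J - n, by omega⟩
    have h1 := ih (by omega)
    rw [show n + a + 1 - n = a + 1 by omega] at h1
    rw [show n + a + 1 - (n + 1) = a by omega, reps, show n + a - n = a by omega]
    rw [pow_succ]
    nlinarith

theorem sum_reps_le (K J : ℕ) :
    ∑ j ∈ Finset.range (J + 1), 2 * reps K J j ≤ 72 * ((J + 1) * (K + J)) := by
  calc _ ≤ ∑ j ∈ Finset.range (J + 1), 72 * (K + J) := by
        refine Finset.sum_le_sum fun j _ => ?_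
        rw [reps]; omega
    _ = _ := by simp; ring

end

section

variable {m q g c G : ℕ} {p : Algorithm (m + 1)}

/-- A fresh second qudit ends the run, so whatever follows does not enter the current run. -/
theorem CostLE.refreshSecond (h : CostLE p q g c G) (hG : quditBits (m + 1) ≤ G) :
    CostLE (refreshSecond p) q (g + quditBits (m + 1)) (quditBits (m + 1)) G where
  queries := Finset.sup_le fun _ _ => h.queries
  gates := Finset.sup_le fun _ _ => Nat.add_le_add_right h.gates _
  currentRun := Finset.sup_le fun _ _ => le_rfl
  gatesPerRun := Finset.sup_le fun _ _ => max_le hG h.gatesPerRun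

theorem CostLE.refreshFirst (h : CostLE p q g c G) (hG : c + quditBits (m + 1) ≤ G) :
    CostLE (refreshFirst p) q (g + quditBits (m + 1)) (c + quditBits (m + 1)) G where
  queries := Finset.sup_le fun _ _ => h.queries
  gates := Finset.sup_le fun _ _ => Nat.add_le_add_right h.gates _
  currentRun := Finset.sup_le fun _ _ => Nat.add_le_add_right h.currentRun _
  gatesPerRun := Finset.sup_le fun _ _ =>
    max_le ((Nat.add_le_add_right h.currentRun _).trans hG) h.gatesPerRun

/-- A run consists of its tests and the preparation that ends it; the second `quditBits` leaves room
for the initial preparation of the first qudit. -/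
theorem costLE_runs (K J n : ℕ) (S : PhaseSet) {Q R : ℕ}
    (hQ : ∑ j ∈ Finset.range (J + 1), 2 * reps K J j * 2 ^ j ≤ Q)
    (hR : (∑ j ∈ Finset.range (J + 1), 2 * reps K J j) * testGates (m + 1) ≤ R) :
    CostLE (runs (m := m) K J n S) (n * Q) (n * (R + quditBits (m + 1))) (quditBits (m + 1))
      (R + 2 * quditBits (m + 1)) := by
  induction n generalizing S with
  | zero => exact ⟨le_rfl.trans (Nat.zero_le _), Nat.zero_le _, Nat.zero_le _, Nat.zero_le _⟩
  | succ n ih =>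
    have h1 := (CostLE.estimate (fun A => ih (S.insertPick A)) K J (J + 1) (by omega)
      (Set.Ico 0 (2 * Real.pi))).refreshSecond (by omega)
    refine ⟨h1.queries.trans ?_, h1.gates.trans ?_, h1.currentRun, h1.gatesPerRun⟩
    · rw [Nat.succ_mul]; omega
    · rw [Nat.succ_mul]; omega

end

/-! ### Hausdorff distance of the output -/

theorem coe_toIcoMod (x : ℝ) :
    ((toIcoMod Real.two_pi_pos 0 x : ℝ) : AddCircle (2 * Real.pi)) = x := by
  rw [← sub_eq_zero, ← AddCircle.coe_sub, AddCircle.coe_eq_zero_iff]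
  exact ⟨-toIcoDiv Real.two_pi_pos 0 x, by rw [toIcoMod]; simp⟩

/-- The eigenphase `θ b`, relative to the eigenphase `θ a`. -/
def relPhase {d : ℕ} (θ : Fin d → ℝ) (a b : Fin d) : ℝ :=
  toIcoMod Real.two_pi_pos 0 (θ b - θ a)

theorem relPhase_mem_Ico {d : ℕ} (θ : Fin d → ℝ) (a b : Fin d) :
    relPhase θ a b ∈ Set.Ico 0 (2 * Real.pi) := by
  simpa [relPhase] using toIcoMod_mem_Ico Real.two_pi_pos 0 (θ b - θ a)

theorem IsEigenbasis.isEigenpair {d : ℕ} {Z : Matrix (Fin d) (Fin d) ℂ}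
    {v : Fin d → Fin d → ℂ} {θ : Fin d → ℝ} (h : IsEigenbasis Z v θ) (a b : Fin d) :
    IsEigenpair Z (v a) (v b) (relPhase θ a b) := by
  refine ⟨θ a, θ b, toIcoDiv Real.two_pi_pos 0 (θ b - θ a), h.mulVec a, h.mulVec b, ?_⟩
  have := toIcoMod_add_toIcoDiv_zsmul Real.two_pi_pos 0 (θ b - θ a)
  rw [relPhase, ← zsmul_eq_mul, this]

/-- The shift by `-θ a` turns the eigenphases into the phases relative to the reference eigenvector.
-/
theorem shiftHausdorff_le {d : ℕ} {Z : Matrix (Fin d) (Fin d) ℂ} {v : Fin d → Fin d → ℂ}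
    {θ : Fin d → ℝ} (h : IsEigenbasis Z v θ) (a : Fin d) {S : Finset ℝ} {ε : ℝ}
    (h1 : ∀ z ∈ S, ∃ b, ‖((z - relPhase θ a b : ℝ) : AddCircle (2 * Real.pi))‖ ≤ ε)
    (h2 : ∀ b, ∃ z ∈ S, ‖((z - relPhase θ a b : ℝ) : AddCircle (2 * Real.pi))‖ ≤ ε) :
    shiftHausdorff (eigenphases Z) S ≤ ENNReal.ofReal ε := by
  have hτ : toIcoMod Real.two_pi_pos 0 (-θ a) ∈ Set.Ico 0 (2 * Real.pi) := by
    simpa using toIcoMod_mem_Ico Real.two_pi_pos 0 (-θ a)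
  set τ := toIcoMod Real.two_pi_pos 0 (-θ a) with hτ_def
  have hb : ∀ b, ((θ b + τ : ℝ) : AddCircle (2 * Real.pi)) = (relPhase θ a b : ℝ) := by
    intro b
    rw [relPhase, coe_toIcoMod, AddCircle.coe_add, hτ_def, coe_toIcoMod, ← AddCircle.coe_add,
      sub_eq_add_neg]
  have hd : ∀ z b, ‖((z - relPhase θ a b : ℝ) : AddCircle (2 * Real.pi))‖ ≤ ε →
      edist ((θ b + τ : ℝ) : AddCircle (2 * Real.pi)) ((z + 0 : ℝ) : AddCircle (2 * Real.pi)) ≤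
        ENNReal.ofReal ε := by
    intro z b hz
    rw [edist_dist]
    apply ENNReal.ofReal_le_ofReal
    rwa [hb, add_zero, dist_comm, dist_eq_norm, ← AddCircle.coe_sub]
  refine iInf₂_le_of_le τ hτ (Metric.hausdorffEDist_le_of_mem_edist ?_ ?_)
  · rw [h.eigenphases_eq]
    rintro _ ⟨_, ⟨b, rfl⟩, rfl⟩
    obtain ⟨z, hz, hzb⟩ := h2 b
    exact ⟨_, ⟨z, hz, rfl⟩, hd z b hzb⟩
  · rw [h.eigenphases_eq]
    rintro _ ⟨z, hz, rfl⟩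
    obtain ⟨b, hzb⟩ := h1 z hz
    exact ⟨_, ⟨_, ⟨b, rfl⟩, rfl⟩, (edist_comm _ _).trans_le (hd z b hzb)⟩

/-! ### The algorithm -/

/-- The number of binary digits needed for precision `ε`. -/
def precisionBits (ε : ℝ) : ℕ := Nat.clog 2 ⌈4 / ε⌉₊

/-- The set that contains only the phase `0`. -/
def zeroPhase : PhaseSet := ⟨{0}, by simp [Real.pi_pos]⟩

/-- The estimation of the eigenphases up to a global shift. -/
def eigenphaseAlgorithm : (d : ℕ) → ℝ → Algorithm d
  | 0, _ => .output zeroPhase.1 zeroPhase.2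
  | m + 1, ε =>
    open Classical in
    -- No query may be needed here: for `d = 1` the query bound vanishes with `log d`, and the
    -- allowed error probability is `1`; for `ε ≥ 4 > π` any two points of the circle are within
    -- `ε`.
    if m = 0 ∨ 4 ≤ ε then .output zeroPhase.1 zeroPhase.2
    else refreshFirst (runs (114 * quditBits (m + 1)) (precisionBits ε)
      (102 * (m + 1) * quditBits (m + 1)) ⟨∅, by simp⟩)

/-! ### Choice of parameters and error probability. -/

theorem two_pow_precisionBits {ε : ℝ} (h0 : 0 < ε) (h4 : ε < 4) :
    4 / ε ≤ 2 ^ precisionBits ε ∧ (2 : ℝ) ^ precisionBits ε ≤ 16 / ε := by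
  have h1 : 1 < 4 / ε := by rwa [one_lt_div h0]
  have hc : 1 < ⌈4 / ε⌉₊ := by
    rw [Nat.lt_ceil]; simpa using h1
  constructor
  · calc 4 / ε ≤ (⌈4 / ε⌉₊ : ℝ) := Nat.le_ceil _
      _ ≤ _ := by exact_mod_cast Nat.le_pow_clog (by norm_num) _
  · have h2 := Nat.pow_pred_clog_lt_self (b := 2) (by norm_num) hc
    have h3 : 0 < precisionBits ε := Nat.clog_pos (by norm_num) hc
    have h5 : (2 : ℝ) ^ (precisionBits ε - 1) < ⌈4 / ε⌉₊ := by exact_mod_cast h2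
    have h6 : (2 : ℝ) ^ precisionBits ε = 2 * 2 ^ (precisionBits ε - 1) := by
      rw [← pow_succ']; congr 1; omega
    have h7 := Nat.ceil_lt_add_one (by positivity : 0 ≤ 4 / ε)
    have h8 : 16 / ε = 4 * (4 / ε) := by ring
    rw [h6, h8]
    linarith

/-- Let `y = 2 ^ (-L)`, so `d y ≤ 1` and `L y ≤ 1`. Of the `114` factors `y` in the first term, two
absorb `d` and `L`, eleven absorb `102 * 16 ≤ 2 ^ 11`, and `101` remain. In the second, `(1 - 1/d) ^
d ≤ 1/2` gives `102` factors, one of which absorbs `d`. Finally `2 y ≤ 1`. -/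
theorem failure_le {d L : ℕ} (hd : 0 < d) (hL : 0 < L) (hdL : d ≤ 2 ^ L) :
    ((102 * d * L : ℕ) : ℝ) * (16 * (1 / 2) ^ (114 * L)) +
      d * (1 - 1 / (d : ℝ)) ^ (102 * d * L) ≤ ((d : ℝ) ^ 100)⁻¹ := by
  have hd' : (0 : ℝ) < d := by exact_mod_cast hd
  have hd1 : (1 : ℝ) ≤ d := by exact_mod_cast hd
  set y : ℝ := (1 / 2) ^ L with hy
  have hy0 : 0 < y := by positivity
  have hy_half : y ≤ 1 / 2 := by
    calc y ≤ (1 / 2) ^ 1 := pow_le_pow_of_le_one (by norm_num) (by norm_num) hL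
      _ = _ := by norm_num
  have hdy : d * y ≤ 1 := by
    have h1 : (d : ℝ) ≤ 2 ^ L := by exact_mod_cast hdL
    calc d * y ≤ 2 ^ L * y := by gcongr
      _ = 1 := by rw [hy, ← mul_pow]; norm_num
  have hLy : L * y ≤ 1 := by
    have h1 : (L : ℝ) ≤ 2 ^ L := by exact_mod_cast Nat.lt_two_pow_self.le
    calc L * y ≤ 2 ^ L * y := by gcongr
      _ = 1 := by rw [hy, ← mul_pow]; norm_num
  have h1 : ((102 * d * L : ℕ) : ℝ) * (16 * (1 / 2) ^ (114 * L)) ≤ y ^ 101 := by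
    rw [mul_comm 114 L, pow_mul, ← hy]
    have h2 : y ^ 11 ≤ (1 / 2) ^ 11 := pow_le_pow_left₀ hy0.le hy_half 11
    calc _ = 1632 * y ^ 11 * ((d * y) * (L * y)) * y ^ 101 := by push_cast; ring
      _ ≤ 1 * y ^ 101 := by
        gcongr
        calc _ ≤ (1632 * (1 / 2 : ℝ) ^ 11) * (1 * 1) := by gcongr
          _ ≤ 1 := by norm_num
      _ = _ := one_mul _
  have h2 : d * (1 - 1 / (d : ℝ)) ^ (102 * d * L) ≤ y ^ 101 := by
    have h3 : (1 - 1 / (d : ℝ)) ^ d ≤ 1 / 2 := by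
      have h4 : 1 - 1 / (d : ℝ) ≤ Real.exp (-(1 / d)) := by
        linarith [Real.add_one_le_exp (-(1 / (d : ℝ)))]
      have h5 : 0 ≤ 1 - 1 / (d : ℝ) := by
        rw [sub_nonneg, div_le_one hd']; exact hd1
      calc _ ≤ Real.exp (-(1 / d)) ^ d := pow_le_pow_left₀ h5 h4 d
        _ = Real.exp (-1) := by
          rw [← Real.exp_nat_mul]; congr 1; field_simp
        _ ≤ 1 / 2 := by
          rw [Real.exp_neg, inv_le_comm₀ (Real.exp_pos _) (by norm_num)]
          linarith [Real.add_one_le_exp 1]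
    have h5 : 0 ≤ (1 - 1 / (d : ℝ)) ^ d := by
      apply pow_nonneg
      rw [sub_nonneg, div_le_one hd']; exact hd1
    calc d * (1 - 1 / (d : ℝ)) ^ (102 * d * L) = d * ((1 - 1 / (d : ℝ)) ^ d) ^ (L * 102) := by
          rw [← pow_mul]; congr 2; ring
      _ ≤ d * (1 / 2) ^ (L * 102) := by gcongr
      _ = (d * y) * y ^ 101 := by rw [pow_mul, ← hy]; ring
      _ ≤ 1 * y ^ 101 := by gcongr
      _ = _ := one_mul _
  have h3 : y ^ 100 ≤ ((d : ℝ) ^ 100)⁻¹ := by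
    rw [← inv_pow]
    apply pow_le_pow_left₀ hy0.le
    rw [inv_eq_one_div, le_div_iff₀ hd', mul_comm]
    exact hdy
  calc _ ≤ y ^ 101 + y ^ 101 := add_le_add h1 h2
    _ = 2 * y * y ^ 100 := by ring
    _ ≤ 1 * y ^ 100 := by
      gcongr
      linarith
    _ ≤ _ := by rwa [one_mul]

theorem prob_output_le {d : ℕ} {S : Finset ℝ} (hS : (S : Set ℝ) ⊆ Set.Ico 0 (2 * Real.pi))
    {m : ℕ} (hd : d = m + 1) (Z : Matrix (Fin d) (Fin d) ℂ) (E : Finset ℝ → Prop) :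
    (Algorithm.output S hS).prob Z E ≤ ind (E S) := by
  subst hd
  have h0 : ∑ i, star ((Pi.single 0 1 : Fin (m + 1) → ℂ) i) * (Pi.single 0 1 : _ → ℂ) i = 1 := by
    simp [Pi.single_apply]
  simp only [Algorithm.prob, Algorithm.probFrom, initialState_eq, trace_prodState h0 h0]
  simp [ind]

theorem prob_eigenphaseAlgorithm_le {d : ℕ} {ε : ℝ} (hd : 1 ≤ d) (hε : 0 < ε)
    {Z : Matrix (Fin d) (Fin d) ℂ} (hZ : Z ∈ Matrix.unitaryGroup (Fin d) ℂ) :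
    (eigenphaseAlgorithm d ε).prob Z (fun S =>
      ¬ shiftHausdorff (eigenphases Z) (S : Set ℝ) ≤ ENNReal.ofReal ε) ≤ ((d : ℝ) ^ 100)⁻¹ := by
  obtain ⟨m, rfl⟩ : ∃ m, d = m + 1 := ⟨d - 1, by omega⟩
  obtain ⟨v, θ, hv⟩ := exists_isEigenbasis hZ
  rw [eigenphaseAlgorithm]
  split_ifs with hcase
  · refine (prob_output_le _ rfl Z _).trans ?_
    rcases hcase with rfl | h4
    · refine (ind_le_one _).trans ?_
      norm_num
    · rw [ind_false]
      · positivity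
      · rw [not_not]
        have hle : ∀ x : AddCircle (2 * Real.pi), ‖x‖ ≤ ε := by
          intro x
          refine (AddCircle.norm_le_half_period _ Real.two_pi_pos.ne').trans ?_
          rw [abs_of_pos Real.two_pi_pos]
          linarith [Real.pi_le_four]
        exact shiftHausdorff_le hv 0 (fun z _ => ⟨0, hle _⟩)
          fun b => ⟨0, by simp [zeroPhase], hle _⟩
  · rw [not_or, not_le] at hcase
    have hJ := (two_pow_precisionBits hε hcase.2).1
    have hd2 : 1 < m + 1 := by omega
    have hL : 0 < quditBits (m + 1) := Nat.clog_pos (by norm_num) hd2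
    have hdL : m + 1 ≤ 2 ^ quditBits (m + 1) := Nat.le_pow_clog (by norm_num) _
    have h0 : ∑ i, star ((Pi.single 0 1 : Fin (m + 1) → ℂ) i) * (Pi.single 0 1 : _ → ℂ) i = 1 := by
      simp [Pi.single_apply]
    have hprec : Real.pi / 3 / 2 ^ precisionBits ε ≤ ε := by
      rw [div_le_iff₀ hε] at hJ
      rw [div_le_iff₀ (by positivity)]
      linarith [Real.pi_le_four]
    -- The shift depends on the reference `a`, but the bad event does not, as it minimizes over
    -- shifts; so bounds for all `a` carry over to the random reference.
    have hrun : ∀ a, ProbLE Z (fun S =>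
        ¬ shiftHausdorff (eigenphases Z) (S : Set ℝ) ≤ ENNReal.ofReal ε) (v a) (Pi.single 0 1)
        (runs (114 * quditBits (m + 1)) (precisionBits ε)
          (102 * (m + 1) * quditBits (m + 1)) ⟨∅, by simp⟩) (((m + 1 : ℕ) : ℝ) ^ 100)⁻¹ := by
      intro a
      refine (probLE_runs hv (by rw [hv.ortho, if_pos rfl]) (fun b => hv.isEigenpair a b)
        (relPhase_mem_Ico θ a) (by omega)
        (near := fun z b => ‖((z - relPhase θ a b : ℝ) : AddCircle (2 * Real.pi))‖ ≤ ε)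
        (fun z b h => h.trans hprec) ?_ _ _ h0).mono ?_
      · intro S hS
        by_contra! hcon
        exact hS (shiftHausdorff_le hv a hcon.1 hcon.2)
      · refine le_trans (le_of_eq ?_) (failure_le (Nat.succ_pos m) hL hdL)
        rw [ind_false (by simp)]
        simp only [Finset.notMem_empty, false_implies, implies_true, ind_true, one_mul,
          Finset.sum_const, Finset.card_univ, Fintype.card_fin, nsmul_eq_mul, zero_add]
        push_cast
        rfl
    have := probLE_refreshFirst hv (Pi.single 0 1) h0 hrun false
    rwa [Algorithm.prob, initialState_eq]

/-! ### Query and gate counts. -/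

theorem quditBits_le {d : ℕ} (hd : 1 < d) : (quditBits d : ℝ) ≤ 3 * Real.log d := by
  have h1 : (2 : ℝ) ^ (quditBits d - 1) < d := by
    exact_mod_cast Nat.pow_pred_clog_lt_self (b := 2) (by norm_num) hd
  have hL : 0 < quditBits d := Nat.clog_pos (by norm_num) hd
  have h2 := Real.log_lt_log (by positivity) h1
  rw [Real.log_pow, Nat.cast_sub hL, Nat.cast_one] at h2
  have h3 : Real.log 2 ≤ Real.log d := Real.log_le_log (by norm_num) (by exact_mod_cast hd)
  have h4 := Real.log_two_gt_d9
  have h5 : (0 : ℝ) ≤ quditBits d := Nat.cast_nonneg _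
  nlinarith

/-- With `x = d / ε + 2 ≥ 2`, the bound `ε < 4` gives `d ≤ 4 x ≤ x ^ 3`, and `2 ^ J ≤ 16 / ε ≤ x ^
5`. -/
theorem le_log_of_lt_four {d : ℕ} {ε : ℝ} (hd : 1 < d) (hε : 0 < ε) (h4 : ε < 4) :
    1 ≤ 9 * Real.log (d / ε + 2) ∧ (quditBits d : ℝ) ≤ 9 * Real.log (d / ε + 2) ∧
      (precisionBits ε : ℝ) ≤ 9 * Real.log (d / ε + 2) := by
  have hd' : (1 : ℝ) < d := by exact_mod_cast hd
  have hx0 : 0 < d / ε := by positivity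
  set x := d / ε + 2 with hx
  have hx2 : 2 ≤ x := by linarith
  have hlog : Real.log 2 ≤ Real.log x := Real.log_le_log (by norm_num) hx2
  have hl2 := Real.log_two_gt_d9
  have hsq : 4 ≤ x ^ 2 := by nlinarith
  refine ⟨by linarith, ?_, ?_⟩
  · have h1 : (d : ℝ) ≤ x ^ 3 := by
      have : d = ε * (d / ε) := by field_simp
      have h2 : ε * (d / ε) ≤ 4 * (d / ε) := by gcongr
      calc (d : ℝ) ≤ 4 * x := by linarith
        _ ≤ x ^ 2 * x := by gcongr
        _ = _ := by ring
    have h2 := Real.log_le_log (by linarith) h1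
    rw [Real.log_pow] at h2
    push_cast at h2
    linarith [quditBits_le hd]
  · have h1 : (2 : ℝ) ^ precisionBits ε ≤ x ^ 5 := by
      have h2 : 1 / ε ≤ d / ε := by gcongr
      calc (2 : ℝ) ^ precisionBits ε ≤ 16 / ε := (two_pow_precisionBits hε h4).2
        _ = 16 * (1 / ε) := by ring
        _ ≤ 4 * 4 * x := by linarith
        _ ≤ x ^ 2 * x ^ 2 * x := by gcongr
        _ = _ := by ring
    have h2 := Real.log_le_log (by positivity) h1
    rw [Real.log_pow, Real.log_pow] at h2
    push_cast at h2
    have h5 : (0 : ℝ) ≤ precisionBits ε := Nat.cast_nonneg _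
    nlinarith

theorem costs_eigenphaseAlgorithm_le {d : ℕ} {ε : ℝ} (hd : 1 ≤ d) (hε : 0 < ε) :
    ((eigenphaseAlgorithm d ε).queries : ℝ) ≤ 10 ^ 12 * (d / ε) * Real.log d ^ 2 ∧
      ((eigenphaseAlgorithm d ε).gatesPerRun : ℝ) ≤ 10 ^ 12 * Real.log (d / ε + 2) ^ 4 ∧
      ((eigenphaseAlgorithm d ε).gates : ℝ) ≤ 10 ^ 12 * d * Real.log (d / ε + 2) ^ 4 := by
  obtain ⟨m, rfl⟩ : ∃ m, d = m + 1 := ⟨d - 1, by omega⟩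
  rw [eigenphaseAlgorithm]
  split_ifs with hcase
  · simp only [Algorithm.queries, Algorithm.gatesPerRun, Algorithm.gates, Nat.cast_zero]
    refine ⟨by positivity, by positivity, by positivity⟩
  · rw [not_or, not_le] at hcase
    have hd2 : 1 < m + 1 := by omega
    have hJ := (two_pow_precisionBits hε hcase.2).2
    have hLlog := quditBits_le hd2
    obtain ⟨hW1, hWL, hWJ⟩ := le_log_of_lt_four hd2 hε hcase.2
    have hL : 0 < quditBits (m + 1) := Nat.clog_pos (by norm_num) hd2
    set d := m + 1
    set L := quditBits d with hL_def
    set J := precisionBits ε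
    have hQ := sum_reps_mul_two_pow_le (114 * L) J (le_refl (J + 1))
    rw [Nat.sub_self, add_zero] at hQ
    have hR := Nat.mul_le_mul_right (testGates d) (sum_reps_le (114 * L) J)
    have hcost := (costLE_runs (m := m) (114 * L) J (102 * d * L) ⟨∅, by simp⟩ hQ
      (hR.trans (Nat.le_add_right _ L))).refreshFirst (by omega)
    rw [testGates, ← hL_def] at hcost
    set W := 9 * Real.log ((d : ℕ) / ε + 2) with hW
    have hW4 : Real.log ((d : ℕ) / ε + 2) ^ 4 = W ^ 4 / 6561 := by rw [hW]; ring
    have hL1 : (1 : ℝ) ≤ L := by exact_mod_cast hL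
    have hJ0 : (0 : ℝ) ≤ J := Nat.cast_nonneg _
    have hd0 : (0 : ℝ) < d := by exact_mod_cast (by omega : 0 < d)
    have hWW : W ^ 3 ≤ W ^ 4 := pow_le_pow_right₀ hW1 (by norm_num)
    have hW3 : W ≤ W ^ 3 := le_self_pow₀ hW1 (by norm_num)
    -- The number of tests in a run is quadratic in `W`, and the gates of a test are linear; the
    -- factor `L` in the number of runs gives the fourth power in the total.
    have hRW : (72 * (((J : ℝ) + 1) * (114 * L + J)) * (18 * L + 4)) ≤ 364320 * W ^ 3 := by
      calc _ ≤ 72 * ((W + W) * (114 * W + W)) * (18 * W + 4 * W) := by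
            gcongr
            linarith
        _ = _ := by ring
    refine ⟨?_, ?_, ?_⟩
    · refine (Nat.cast_le.mpr hcost.queries).trans ?_
      change _ ≤ 10 ^ 12 * ((d : ℝ) / ε) * Real.log (d : ℝ) ^ 2
      push_cast
      -- One factor `L` comes from the number of runs, the other from the repetitions within a run.
      calc (_ : ℝ) = 14688 * d * L * (2 ^ J * (114 * L + 1)) := by ring
        _ ≤ 14688 * d * L * ((16 / ε) * (114 * L + L)) := by gcongr
        _ = 27025920 * (d / ε) * L ^ 2 := by ring
        _ ≤ 27025920 * (d / ε) * (3 * Real.log d) ^ 2 := by gcongr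
        _ = 243233280 * ((d / ε) * Real.log d ^ 2) := by ring
        _ ≤ 10 ^ 12 * ((d / ε) * Real.log d ^ 2) := by
          apply mul_le_mul_of_nonneg_right (by norm_num)
          positivity
        _ = _ := by ring
    · refine (Nat.cast_le.mpr hcost.gatesPerRun).trans ?_
      change _ ≤ 10 ^ 12 * Real.log ((d : ℝ) / ε + 2) ^ 4
      rw [hW4]
      push_cast
      calc _ ≤ 364320 * W ^ 3 + W + 2 * W := by gcongr
        _ ≤ 364320 * W ^ 4 + W ^ 4 + 2 * W ^ 4 := by gcongr <;> linarith
        _ ≤ _ := by linarith [pow_nonneg (zero_le_one.trans hW1) 4]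
    · refine (Nat.cast_le.mpr hcost.gates).trans ?_
      change _ ≤ 10 ^ 12 * (d : ℝ) * Real.log ((d : ℝ) / ε + 2) ^ 4
      rw [hW4]
      push_cast
      have hd1 : (1 : ℝ) ≤ d := by exact_mod_cast hd
      calc _ ≤ 102 * d * W * (364320 * W ^ 3 + W + W) + 1 * W := by
            rw [one_mul]
            gcongr
        _ ≤ 102 * d * W * (364320 * W ^ 3 + W ^ 3 + W ^ 3) + d * W ^ 4 := by
          gcongr
          linarith
        _ = 37160845 * (d * W ^ 4) := by ring
        _ ≤ _ := by
          have : 0 ≤ d * W ^ 4 := by positivity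
          linarith

end EigenphaseEstimation

end

theorem theoremB2 :
    ∃ (C : ℝ) (k : ℕ) (alg : (d : ℕ) → ℝ → EigenphaseEstimation.Algorithm d),
      ∀ (d : ℕ) (ε : ℝ), 1 ≤ d → 0 < ε →
        ((alg d ε).queries : ℝ) ≤ C * (d / ε) * Real.log d ^ 2 ∧
        ((alg d ε).gatesPerRun : ℝ) ≤ C * Real.log (d / ε + 2) ^ k ∧
        ((alg d ε).gates : ℝ) ≤ C * d * Real.log (d / ε + 2) ^ k ∧
        ∀ Z ∈ Matrix.unitaryGroup (Fin d) ℂ,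
          (alg d ε).prob Z (fun S =>
            ¬ EigenphaseEstimation.shiftHausdorff (EigenphaseEstimation.eigenphases Z) (S : Set ℝ)
              ≤ ENNReal.ofReal ε) ≤ ((d : ℝ) ^ 100)⁻¹ := by
  refine ⟨10 ^ 12, 4, EigenphaseEstimation.eigenphaseAlgorithm, fun d ε hd hε => ?_⟩
  obtain ⟨h1, h2, h3⟩ := EigenphaseEstimation.costs_eigenphaseAlgorithm_le hd hε
  exact ⟨h1, h2, h3, fun Z hZ => EigenphaseEstimation.prob_eigenphaseAlgorithm_le hd hε hZ⟩
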